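/- For $n\ge 0$ let $P_n$ be the planar rook monoid: the monoid, under composition (from right to left), of all order-preserving injective partial functions from $\{1,\dots,n\}$ to itself. It is a finite inverse monoid; write $\operatorname{dom}(s)=s^{-1}s$, $\operatorname{ran}(s)=ss^{-1}$, let $\operatorname{rk}(s)$ be the size of the domain of $s$, and let $\le$ be the natural partial order ($t\le s$ iff $t=es$ for some idempotent $e$, i.e. iff $s$ extends $t$), with Möbius function $\mu$. In the semigroup algebra $\mathbb{C}P_n$ put $\lfloor s\rfloor=\sum_{t\le s}\mu(t,s)\,t$. **Theorem.** For every $n\ge 0$: 1. Two elements of $P_n$ are $\mathcal D$-related (there is $x$ with $\operatorname{dom}(x)=\operatorname{ran}(s)$, $\operatorname{ran}(x)=\operatorname{ran}(t)$) iff they have the same rank, and for every idempotent $e$ the maximal subgroup $\{s:\operatorname{dom}(s)=\operatorname{ran}(s)=e\}$ is $\{e\}$. 2. $(P_n,\le)$ is a meet-semilattice. Let $L(P_n)$ be $P_n$ with a formal maximal element adjoined if $P_n$ is not already a lattice, and $P_n$ otherwise. Then $L(P_n)$ is a lattice, and its join-irreducible elements (those covering exactly one element) are precisely the $n^2$ elements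 of $P_n$ of rank one. 3. There is a complete set $\mathcal Y=\{\rho_0,\dots,\rho_n\}$ of inequivalent irreducible matrix representations of $\mathbb{C}P_n$, where $\rho_k$ is induced from the trivial representation of the maximal subgroup at an idempotent of rank $k$: its rows and columns are indexed by the idempotents of rank $k$, $\rho_k(\lfloor s\rfloor)=E_{\operatorname{ran}(s),\operatorname{dom}(s)}$ (matrix unit) if $\operatorname{rk}(s)=k$, and $\rho_k(\lfloor s\rfloor)=0$ otherwise. The Fourier transform $f\mapsto\hat f=(\rho_k(f))_{0\le k\le n}$ is a bijection from $\mathbb{C}P_n$ onto $\prod_k M_{r_k}(\mathbb{C})$, where $r_k$ is the number of idempotents of rank $k$. 4. The transforms reduce to zeta and Möbius transforms: $s\mapsto(\operatorname{rk}(s),\operatorname{ran}(s),\operatorname{dom}(s))$ is a bijection from $P_n$ onto the set of all triples $(k,a,b)$ with $0\le k\le n$ and $a,b$ idempotents of rank $k$; and for all $f=\sum_s f(s)s\in\mathbb{C}P_n$ and $s\in P_n$, $$\hat f_{s}=\sum_{t\ge s}f(t),\qquad f(s)=\sum_{t\ge s}\mu(s,t)\,\hat f_{t},$$ where $\hat f_{s}$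 is the $(\operatorname{ran}(s),\operatorname{dom}(s))$ entry of $\rho_{k}(f)$ for $k=\operatorname{rk}(s)$. 5. The Fourier transform relative to $\mathcal Y$ (computing all entries of the matrices $\rho_k(f)$ from the coefficients $f(s)$) and the inverse Fourier transform relative to $\mathcal Y$ (computing all coefficients $f(s)$ from the entries of the matrices $\rho_k(f)$), for arbitrary $f\in\mathbb{C}P_n$, can each be computed in at most $C\,|P_n|\log^2|P_n|$ operations, with an absolute constant $C$ independent of $n$. Here the computation is by a straight-line program depending only on $n$, and each addition of two complex numbers and each multiplication by a complex constant counts as one operation. -/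

import Mathlib

noncomputable section

/-! ### Linear programs over the complex numbers and their operation counts -/

/-- One arithmetic operation on previously available values: an addition of two of them, or a
multiplication of one of them by a complex constant. -/
inductive LinGate (V : Type) : Type where
  | add (u v : V) : LinGate V
  | smul (c : ℂ) (u : V) : LinGate V

/-- The result of an operation when the available values are given by `val`. -/
def LinGate.eval {V : Type} (val : V → ℂ) : LinGate V → ℂ
  | .add u v => val u + val v
  | .smul c u => c * val u

/-- A straight-line program with inputs indexed by `X`, outputs indexed by `Z`, and exactly `m`
operations: the `i`-th operation acts on inputs and on results of earlier operations, and every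
output is an input or the result of an operation. -/
structure LinProg (X Z : Type) (m : ℕ) : Type where
  gate : (i : Fin m) → LinGate (X ⊕ Fin (i : ℕ))
  out : Z → X ⊕ Fin m

/-- On input `x` the program outputs `z`; here `r i` is the (uniquely determined) result of the
`i`-th operation. -/
def LinProg.Computes {X Z : Type} {m : ℕ} (P : LinProg X Z m) (x : X → ℂ) (z : Z → ℂ) : Prop :=
  ∃ r : Fin m → ℂ,
    (∀ i : Fin m, r i = (P.gate i).eval (Sum.elim x fun j => r (Fin.castLE i.isLt.le j))) ∧
    ∀ o : Z, z o = Sum.elim x r (P.out o)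

/-! ### Matrix representations and the Fourier transform -/

section Representations

variable {A : Type} [Ring A] [Algebra ℂ A]

/-- An irreducible matrix representation: nonzero, and with no invariant subspaces other than
`0` and the whole space. -/
def IsIrreducibleRep {ι : Type} [Fintype ι] [DecidableEq ι] (ρ : A →ₐ[ℂ] Matrix ι ι ℂ) : Prop :=
  Nonempty ι ∧ ∀ W : Submodule ℂ (ι → ℂ),
    (∀ a : A, ∀ w ∈ W, (ρ a).mulVec w ∈ W) → W = ⊥ ∨ W = ⊤

/-- Equivalence of matrix representations. -/
def EquivalentReps {ι κ : Type} [Fintype ι] [DecidableEq ι] [Fintype κ] [DecidableEq κ]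
    (ρ : A →ₐ[ℂ] Matrix ι ι ℂ) (σ : A →ₐ[ℂ] Matrix κ κ ℂ) : Prop :=
  ∃ T : (ι → ℂ) ≃ₗ[ℂ] (κ → ℂ), ∀ (a : A) (v : ι → ℂ), T ((ρ a).mulVec v) = (σ a).mulVec (T v)

/-- A complete set of inequivalent irreducible matrix representations. -/
structure IsCompleteIrreps {I : Type} {ι : I → Type} [∀ i, Fintype (ι i)] [∀ i, DecidableEq (ι i)]
    (Y : ∀ i, A →ₐ[ℂ] Matrix (ι i) (ι i) ℂ) : Prop where
  irreducible : ∀ i, IsIrreducibleRep (Y i)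
  inequivalent : ∀ i j, i ≠ j → ¬ EquivalentReps (Y i) (Y j)
  complete : ∀ (d : ℕ) (ρ : A →ₐ[ℂ] Matrix (Fin d) (Fin d) ℂ),
    IsIrreducibleRep ρ → ∃ i, EquivalentReps ρ (Y i)

/-- The Fourier transform relative to `Y`: the collection of all entries of all the matrices
`Y i f`, indexed by triples (representation, row, column). -/
def fourierTransform {I : Type} {ι : I → Type} [∀ i, Fintype (ι i)] [∀ i, DecidableEq (ι i)]
    (Y : ∀ i, A →ₐ[ℂ] Matrix (ι i) (ι i) ℂ) (f : A) : (Σ i, ι i × ι i) → ℂ :=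
  fun x => Y x.1 f x.2.1 x.2.2

end Representations

/-! ### Zeta and Möbius transforms, join-irreducibles -/

section Order

open Classical in
/-- `s ↦ ∑_{t ≥ s} f t`. -/
def zetaTransform {M : Type} [PartialOrder M] [Fintype M] (f : M → ℂ) (s : M) : ℂ :=
  ∑ t with s ≤ t, f t

open Classical in
/-- `s ↦ ∑_{t ≥ s} μ(s, t) f t`, with `μ` the Möbius function of `M`. -/
def moebiusTransform {M : Type} [PartialOrder M] [Fintype M] [LocallyFiniteOrder M]
    (f : M → ℂ) (s : M) : ℂ :=
  ∑ t with s ≤ t, IncidenceAlgebra.mu ℂ s t * f t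

/-- Any two elements have a greatest lower bound. -/
def IsMeetSemilatticeOrder (M : Type) [PartialOrder M] : Prop :=
  ∀ a b : M, ∃ c, IsGLB {a, b} c

/-- Any two elements have a greatest lower bound and a least upper bound. -/
def IsLatticeOrder (M : Type) [PartialOrder M] : Prop :=
  IsMeetSemilatticeOrder M ∧ ∀ a b : M, ∃ c, IsLUB {a, b} c

/-- `M` with a formal maximal element adjoined if `M` is not already a lattice, and `M` itself
otherwise. -/
abbrev LatticeCompletion (M : Type) [PartialOrder M] : Type :=
  {x : WithTop M // x = ⊤ → ¬ IsLatticeOrder M}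

/-- An element is join-irreducible if it covers exactly one element. -/
def IsJoinIrreducible {L : Type} [PartialOrder L] (j : L) : Prop :=
  ∃! x : L, x ⋖ j

end Order

/-! ### The planar rook monoid -/

/-- The planar rook monoid: injective partial functions from an `n`-set to itself (elements of the
rook monoid, here Mathlib's partial equivalences) which are order-preserving on their domain. -/
def PlanarRook (n : ℕ) : Type :=
  {σ : Fin n ≃. Fin n // ∀ i j a b : Fin n, i < j → σ i = some a → σ j = some b → a < b}

namespace PlanarRook

variable {n : ℕ}

lemma ext' {σ τ : PlanarRook n} (h : ∀ i a, σ.1 i = some a ↔ τ.1 i = some a) : σ = τ :=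
  Subtype.ext (PEquiv.ext fun i => Option.ext (h i))

/-- Composition from right to left: `σ * τ` applies `τ` first, and is defined where both steps
are. -/
instance : Mul (PlanarRook n) where
  mul σ τ := ⟨τ.1.trans σ.1, by
    intro i j a b hij hi hj
    obtain ⟨c, hc, hca⟩ := (PEquiv.trans_eq_some _ _ _ _).1 hi
    obtain ⟨d, hd, hdb⟩ := (PEquiv.trans_eq_some _ _ _ _).1 hj
    exact σ.2 c d a b (τ.2 i j c d hij hc hd) hca hdb⟩

instance : One (PlanarRook n) where
  one := ⟨PEquiv.refl _, by
    intro i j a b hij hi hj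
    simp only [PEquiv.refl_apply, Option.some.injEq] at hi hj
    rwa [← hi, ← hj]⟩

instance : Inv (PlanarRook n) where
  inv σ := ⟨σ.1.symm, by
    intro i j a b hij hi hj
    have hi' := (PEquiv.eq_some_iff _).1 hi
    have hj' := (PEquiv.eq_some_iff _).1 hj
    rcases lt_trichotomy a b with h | h | h
    · exact h
    · subst h
      rw [hi'] at hj'
      exact absurd (Option.some.inj hj') hij.ne
    · exact absurd (σ.2 b a j i h hj' hi') hij.not_gt⟩

instance : Monoid (PlanarRook n) where
  mul_assoc ρ σ τ := Subtype.ext (PEquiv.trans_assoc τ.1 σ.1 ρ.1).symm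
  one_mul σ := Subtype.ext (PEquiv.trans_refl σ.1)
  mul_one σ := Subtype.ext (PEquiv.refl_trans σ.1)

lemma mul_apply {σ τ : PlanarRook n} {i a : Fin n} :
    (σ * τ).1 i = some a ↔ ∃ b, τ.1 i = some b ∧ σ.1 b = some a :=
  PEquiv.trans_eq_some _ _ _ _

lemma inv_apply {σ : PlanarRook n} {i a : Fin n} : σ⁻¹.1 i = some a ↔ σ.1 a = some i :=
  PEquiv.eq_some_iff _

lemma inj {σ : PlanarRook n} {i j a : Fin n} (hi : σ.1 i = some a) (hj : σ.1 j = some a) :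
    i = j := PEquiv.inj σ.1 hi hj

lemma dom_apply {σ : PlanarRook n} {i a : Fin n} :
    (σ⁻¹ * σ).1 i = some a ↔ i = a ∧ (σ.1 i).isSome := by
  rw [mul_apply]
  constructor
  · rintro ⟨b, hb, hba⟩
    exact ⟨inj hb (inv_apply.1 hba), by simp [hb]⟩
  · rintro ⟨rfl, h⟩
    obtain ⟨b, hb⟩ := Option.isSome_iff_exists.1 h
    exact ⟨b, hb, inv_apply.2 hb⟩

lemma mul_inv_mul (s : PlanarRook n) : s * s⁻¹ * s = s := by
  rw [mul_assoc]
  refine ext' fun i a => ?_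
  rw [mul_apply]
  constructor
  · rintro ⟨b, hb, hba⟩
    rwa [(dom_apply.1 hb).1]
  · intro h
    exact ⟨i, dom_apply.2 ⟨rfl, by simp [h]⟩, h⟩

lemma inv_inv' (s : PlanarRook n) : s⁻¹⁻¹ = s := rfl

lemma inv_mul_inv (s : PlanarRook n) : s⁻¹ * s * s⁻¹ = s⁻¹ := mul_inv_mul s⁻¹

/-- `s⁻¹` is the only inverse of `s` in the sense of inverse semigroups. -/
lemma inv_unique {s t : PlanarRook n} (h₁ : s * t * s = s) (h₂ : t * s * t = t) : t = s⁻¹ := by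
  have key : ∀ {s t : PlanarRook n}, s * t * s = s → ∀ i a, s.1 i = some a → t.1 a = some i := by
    intro s t h i a hi
    have h' := hi
    rw [← h, mul_apply] at h'
    obtain ⟨b, hb, hba⟩ := h'
    obtain ⟨c, hc, hcb⟩ := mul_apply.1 hba
    rw [hi] at hb
    cases hb
    rw [hc, inj hcb hi]
  refine ext' fun i a => ⟨fun h => inv_apply.2 (key h₂ i a h), fun h => key h₁ a i (inv_apply.1 h)⟩

/-- Restriction of partial functions. It coincides with the natural partial order of inverse
semigroups, see `le_iff_exists_idempotent`. -/
instance : PartialOrder (PlanarRook n) := PartialOrder.lift Subtype.val Subtype.val_injective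

lemma isIdempotentElem_dom (s : PlanarRook n) : IsIdempotentElem (s⁻¹ * s) := by
  change s⁻¹ * s * (s⁻¹ * s) = s⁻¹ * s
  rw [← mul_assoc, inv_mul_inv]

lemma isIdempotentElem_ran (s : PlanarRook n) : IsIdempotentElem (s * s⁻¹) :=
  isIdempotentElem_dom s⁻¹

lemma eq_of_isIdempotentElem {e : PlanarRook n} (he : IsIdempotentElem e) {i a : Fin n}
    (h : e.1 i = some a) : i = a := by
  have h' := h
  rw [← he.eq, mul_apply] at h'
  obtain ⟨b, hb, hba⟩ := h'
  rw [h] at hb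
  cases hb
  exact inj h hba

/-- The order is the natural partial order of the inverse semigroup. -/
lemma le_iff_exists_idempotent {s t : PlanarRook n} :
    t ≤ s ↔ ∃ e : PlanarRook n, IsIdempotentElem e ∧ t = e * s := by
  have hle : t ≤ s ↔ ∀ i a, t.1 i = some a → s.1 i = some a := Iff.rfl
  rw [hle]
  constructor
  · intro h
    refine ⟨t * t⁻¹, isIdempotentElem_ran t, ext' fun i a => ?_⟩
    rw [mul_apply]
    constructor
    · intro hi
      refine ⟨a, h i a hi, ?_⟩
      exact mul_apply.2 ⟨i, inv_apply.2 hi, hi⟩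
    · rintro ⟨b, hb, hba⟩
      obtain ⟨c, hc, hca⟩ := mul_apply.1 hba
      have hc' := inv_apply.1 hc
      rwa [inj hb (h c b hc')]
  · rintro ⟨e, he, rfl⟩ i a hi
    obtain ⟨b, hb, hba⟩ := mul_apply.1 hi
    rwa [← eq_of_isIdempotentElem he hba]

instance : DecidableEq (PlanarRook n) := Classical.decEq _

instance : Fintype (PlanarRook n) :=
  Fintype.ofInjective (fun σ : PlanarRook n => (σ.1 : Fin n → Option (Fin n)))
    fun _ _ h => Subtype.ext (DFunLike.coe_injective h)

open Classical in
instance : LocallyFiniteOrder (PlanarRook n) := Fintype.toLocallyFiniteOrder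

/-- The rank of `σ`: the size of its domain. -/
def rank (σ : PlanarRook n) : ℕ :=
  (Finset.univ.filter fun i : Fin n => (σ.1 i).isSome).card

lemma rank_le (σ : PlanarRook n) : σ.rank ≤ n :=
  (Finset.card_filter_le _ _).trans (by simp)

lemma rank_dom (σ : PlanarRook n) : (σ⁻¹ * σ).rank = σ.rank := by
  unfold rank
  congr 1
  ext i
  simp only [Finset.mem_filter, Finset.mem_univ, true_and]
  constructor
  · intro h
    obtain ⟨a, ha⟩ := Option.isSome_iff_exists.1 h
    exact (dom_apply.1 ha).2
  · intro h
    rw [dom_apply.2 ⟨rfl, h⟩]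
    rfl

lemma rank_inv (σ : PlanarRook n) : σ⁻¹.rank = σ.rank := by
  have key : ∀ σ : PlanarRook n, σ.rank ≤ σ⁻¹.rank := by
    intro σ
    refine Finset.card_le_card_of_injOn (fun i => (σ.1 i).getD i) ?_ ?_
    · intro i hi
      obtain ⟨a, ha⟩ := Option.isSome_iff_exists.1 (Finset.mem_filter.1 hi).2
      have : σ⁻¹.1 a = some i := inv_apply.2 ha
      simp [ha, this]
    · intro i hi j hj hij
      obtain ⟨a, ha⟩ := Option.isSome_iff_exists.1 (Finset.mem_filter.1 hi).2
      obtain ⟨b, hb⟩ := Option.isSome_iff_exists.1 (Finset.mem_filter.1 hj).2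
      simp only [ha, hb, Option.getD_some] at hij
      subst hij
      exact inj ha hb
  exact le_antisymm (key σ⁻¹) (key σ)

lemma rank_ran (σ : PlanarRook n) : (σ * σ⁻¹).rank = σ.rank :=
  (rank_dom σ⁻¹).trans (rank_inv σ)

/-- Green's relation `𝒟`: some `x` has `dom x = ran s` and `ran x = ran t`, where
`dom x = x⁻¹ x` and `ran x = x x⁻¹`. -/
def DRel (s t : PlanarRook n) : Prop :=
  ∃ x : PlanarRook n, x⁻¹ * x = s * s⁻¹ ∧ x * x⁻¹ = t * t⁻¹

/-- The maximal subgroup at an idempotent `e`. -/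
def maxSubgroup (e : PlanarRook n) : Set (PlanarRook n) :=
  {s | s⁻¹ * s = e ∧ s * s⁻¹ = e}

/-- The idempotents of rank `k`. -/
abbrev Idem (n k : ℕ) : Type := {a : PlanarRook n // IsIdempotentElem a ∧ a.rank = k}

instance (k : ℕ) : Fintype (Idem n k) := Fintype.ofFinite _

/-- `dom s = s⁻¹ s`, as an idempotent of the rank of `s`. -/
def dom (s : PlanarRook n) {k : ℕ} (h : s.rank = k) : Idem n k :=
  ⟨s⁻¹ * s, isIdempotentElem_dom s, (rank_dom s).trans h⟩

/-- `ran s = s s⁻¹`, as an idempotent of the rank of `s`. -/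
def ran (s : PlanarRook n) {k : ℕ} (h : s.rank = k) : Idem n k :=
  ⟨s * s⁻¹, isIdempotentElem_ran s, (rank_ran s).trans h⟩

/-- The matrix position `(k, ran s, dom s)` belonging to an element `s` of rank `k`. -/
def fourierIndex (s : PlanarRook n) : Σ k : Fin (n + 1), Idem n k × Idem n k :=
  ⟨⟨s.rank, Nat.lt_succ_of_le s.rank_le⟩, s.ran rfl, s.dom rfl⟩

open Classical in
/-- The groupoid basis element `⌊s⌋ = ∑_{t ≤ s} μ(t, s) t` of the semigroup algebra. -/
def groupoidElt (s : PlanarRook n) : MonoidAlgebra ℂ (PlanarRook n) :=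
  ∑ t with t ≤ s, MonoidAlgebra.single t (IncidenceAlgebra.mu ℂ t s)

/-- `ρ` is the representation of the semigroup algebra induced by the trivial one-dimensional
representation `g ↦ 1` of the maximal subgroup at an idempotent `e` of rank `k`, for some choice of
`e` and of elements `p a` with domain `e` and range `a` (`a` an idempotent of rank `k`):
on the elements of rank `k` it is given by `⌊s⌋ ↦ E_{ran s, dom s} ⊗ 1(g)`, where
`g = (p (ran s))⁻¹ s p (dom s)` is an element of the maximal subgroup at `e`, and it vanishes
on `⌊s⌋` for `s` of any other rank. -/
def IsInducedFromTrivial {k : ℕ}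
    (ρ : MonoidAlgebra ℂ (PlanarRook n) →ₐ[ℂ] Matrix (Idem n k) (Idem n k) ℂ) : Prop :=
  ∃ (e : Idem n k) (p : Idem n k → PlanarRook n),
    p e = e.1 ∧
    (∀ a : Idem n k, (p a)⁻¹ * p a = e.1 ∧ p a * (p a)⁻¹ = a.1) ∧
    (∀ (s : PlanarRook n) (h : s.rank = k),
      (p (s.ran h))⁻¹ * s * p (s.dom h) ∈ maxSubgroup e.1 ∧
      ρ (groupoidElt s) = Matrix.single (s.ran h) (s.dom h) 1) ∧
    ∀ s : PlanarRook n, s.rank ≠ k → ρ (groupoidElt s) = 0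

end PlanarRook

end

/-! An element of `PlanarRook n` is determined by its graph, a strict chain in the `n × n` grid, and
the natural order becomes inclusion of graphs. Subsets of strict chains are strict chains, so the
monoid is the face poset of a simplicial complex with `n ^ 2` vertices (`exists_graph_eq`). Meets
are intersections, bounded joins are unions, and the join-irreducibles are the vertices.

Between two finite chains of equal size there is exactly one order isomorphism. Hence domain and
range determine an element (`eq_of_dom_eq_of_ran_eq`), maximal subgroups are trivial, and matrix
positions correspond to monoid elements. In `rankRep`, the element `t` contributes to the position
of `s` exactly when `s ≤ t`, so the Fourier transform is the upward zeta transform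
(`fourierTransform_fourierIndex`). Möbius inversion makes it bijective. The algebra is therefore a
product of matrix algebras, whose coordinate projections form a complete set of irreducibles
(`isCompleteIrreps_of_bijective`).

For the operation count, the zeta transform on a simplicial complex is computed one vertex at a
time: every face that can be extended by the vertex receives the value at its extension. This costs
at most `2 * n ^ 2 * |P_n|` operations, and every pass can be undone at the same cost. Since `|P_n|
≥ 2 ^ n`, the factor `n ^ 2` is `O(log² |P_n|)`. -/

noncomputable section

/-! ### Building linear programs -/

/-- Relabel the operands of an operation. -/
def LinGate.map {V W : Type} (φ : V → W) : LinGate V → LinGate W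
  | .add u v => .add (φ u) (φ v)
  | .smul c u => .smul c (φ u)

lemma LinGate.eval_map {V W : Type} (φ : V → W) (val : W → ℂ) (g : LinGate V) :
    (g.map φ).eval val = g.eval fun v => val (φ v) := by
  cases g <;> rfl

/-- The program `P` followed by the operation `g` on its outputs, whose result is output along
with the outputs of `P`. -/
def LinProg.snoc {X Z : Type} {m : ℕ} (P : LinProg X Z m) (g : LinGate Z) :
    LinProg X (Option Z) (m + 1) where
  gate i := if h : (i : ℕ) < m then P.gate ⟨i, h⟩
    else g.map fun z => (P.out z).map id (Fin.castLE (not_lt.1 h))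
  out o := o.elim (Sum.inr (Fin.last m)) fun z => (P.out z).map id Fin.castSucc

lemma LinProg.Computes.snoc {X Z : Type} {m : ℕ} {P : LinProg X Z m} {x : X → ℂ} {z : Z → ℂ}
    (h : P.Computes x z) (g : LinGate Z) :
    (P.snoc g).Computes x fun o => o.elim (g.eval z) z := by
  obtain ⟨r, hr, hz⟩ := h
  have hz' : z = fun o => Sum.elim x r (P.out o) := funext hz
  refine ⟨fun i => if h : (i : ℕ) < m then r ⟨i, h⟩ else g.eval z, fun i => ?_, fun o => ?_⟩
  · by_cases h : (i : ℕ) < m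
    · simp only [LinProg.snoc, h, dif_pos]
      rw [hr ⟨i, h⟩]
      congr 1
      ext v
      rcases v with v | v
      · rfl
      · have hv : (v : ℕ) < m := v.isLt.trans h
        simp [hv, Fin.castLE]
    · simp only [LinProg.snoc, h, dif_neg, not_false_eq_true]
      rw [LinGate.eval_map]
      congr 1
      rw [hz']
      ext v
      rcases P.out v with w | w
      · rfl
      · simp [Fin.castLE]
  · rcases o with _ | o
    · simp [LinProg.snoc]
    · simp only [Option.elim_some, LinProg.snoc, hz o]
      rcases P.out o with w | w
      · rfl
      · simp

/-- The outputs `outp φ` can be computed from the inputs `inp φ`, for all `φ`, by a single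
straight-line program with at most `m` operations. -/
def IsLinComputable {Φ X Z : Type} (m : ℕ) (inp : Φ → X → ℂ) (outp : Φ → Z → ℂ) : Prop :=
  ∃ k ≤ m, ∃ P : LinProg X Z k, ∀ φ, P.Computes (inp φ) (outp φ)

namespace IsLinComputable

variable {Φ X Z Z' : Type} {m : ℕ} {inp : Φ → X → ℂ} {outp : Φ → Z → ℂ}

lemma mono {m' : ℕ} (h : IsLinComputable m inp outp) (hm : m ≤ m') :
    IsLinComputable m' inp outp := by
  obtain ⟨k, hk, P, hP⟩ := h
  exact ⟨k, hk.trans hm, P, hP⟩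

lemma inputs (ι : Z → X) : IsLinComputable 0 inp fun φ z => inp φ (ι z) :=
  ⟨0, le_rfl, ⟨fun i => i.elim0, fun z => Sum.inl (ι z)⟩,
    fun _ => ⟨fun i => i.elim0, fun i => i.elim0, fun _ => rfl⟩⟩

lemma reindex (h : IsLinComputable m inp outp) (ι : Z' → Z) :
    IsLinComputable m inp fun φ z => outp φ (ι z) := by
  obtain ⟨k, hk, P, hP⟩ := h
  refine ⟨k, hk, ⟨P.gate, fun z => P.out (ι z)⟩, fun φ => ?_⟩
  obtain ⟨r, hr, hz⟩ := hP φ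
  exact ⟨r, hr, fun z => hz (ι z)⟩

lemma snoc (h : IsLinComputable m inp outp) (g : LinGate Z) :
    IsLinComputable (m + 1) inp fun φ (o : Option Z) => o.elim (g.eval (outp φ)) (outp φ) := by
  obtain ⟨k, hk, P, hP⟩ := h
  exact ⟨k + 1, by omega, P.snoc g, fun φ => (hP φ).snoc g⟩

open Classical in
lemma update_add_mul (h : IsLinComputable m inp outp) (c : ℂ) (u v : Z) :
    IsLinComputable (m + 2) inp fun φ =>
      Function.update (outp φ) u (outp φ u + c * outp φ v) := by
  -- The inner `none` holds the product and the outer `none` the sum; old values sit at `some (some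
  -- z)`, and only `u` is redirected to the sum.
  have h' := ((h.snoc (.smul c v)).snoc (.add (some u) none)).reindex
    fun z => if z = u then none else some (some z)
  convert h' using 3 with φ z
  by_cases hz : z = u
  · subst hz
    simp [LinGate.eval]
  · simp [hz]

open Classical in
-- Since every source lies outside `S`, no source is ever overwritten, so sequential updates in any
-- order agree with the simultaneous one.
lemma add_mul_on (h : IsLinComputable m inp outp) (c : ℂ) (S : Finset Z) (src : Z → Z)
    (hsrc : ∀ z ∈ S, src z ∉ S) :
    IsLinComputable (m + 2 * S.card) inp fun φ z =>
      if z ∈ S then outp φ z + c * outp φ (src z) else outp φ z := by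
  suffices H : ∀ T ⊆ S, IsLinComputable (m + 2 * T.card) inp fun φ z =>
      if z ∈ T then outp φ z + c * outp φ (src z) else outp φ z from H S subset_rfl
  intro T
  induction T using Finset.induction_on with
  | empty => intro _; simpa using h
  | insert u T hu ih =>
    intro hT
    have hT' : T ⊆ S := (Finset.subset_insert u T).trans hT
    have huS : u ∈ S := hT (Finset.mem_insert_self u T)
    have h' := ((ih hT').update_add_mul c u (src u)).mono (m' := m + 2 * (insert u T).card)
      (by rw [Finset.card_insert_of_notMem hu]; omega)
    convert h' using 3 with φ z
    have hs : src u ∉ T := fun hs => hsrc u huS (hT' hs)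
    by_cases hz : z = u
    · subst hz
      simp [hu, hs]
    · simp [hz, Finset.mem_insert]

end IsLinComputable

/-! ### Fast zeta and Möbius transforms on simplicial complexes -/

section FastZeta

variable {M X : Type} [PartialOrder M] [Fintype M] [DecidableEq X] (g : M ↪o Finset X)

open Classical in
/-- The zeta transform restricted to those `t ≥ s` all of whose new vertices lie in `L`. -/
def partialZeta (L : Finset X) (f : M → ℂ) (s : M) : ℂ :=
  ∑ t with s ≤ t ∧ g t ⊆ g s ∪ L, f t

lemma partialZeta_empty (f : M → ℂ) : partialZeta g ∅ f = f := by
  classical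
  ext s
  have : (Finset.univ.filter fun t => s ≤ t ∧ g t ⊆ g s ∪ ∅) = {s} := by
    ext t
    simp only [Finset.union_empty, Finset.mem_filter, Finset.mem_univ, true_and,
      Finset.mem_singleton]
    constructor
    · rintro ⟨h₁, h₂⟩
      exact le_antisymm (g.le_iff_le.1 h₂) h₁
    · rintro rfl
      simp
  unfold partialZeta
  convert Finset.sum_singleton f s

lemma partialZeta_univ [Fintype X] (f : M → ℂ) :
    partialZeta g Finset.univ f = zetaTransform f := by
  ext s
  refine Finset.sum_congr ?_ fun _ _ => rfl
  ext t
  simp [Finset.union_eq_right.2 (Finset.subset_univ (g s))]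

lemma partialZeta_insert_of_mem {L : Finset X} {x : X} (f : M → ℂ) {s : M} (hx : x ∈ g s) :
    partialZeta g (insert x L) f s = partialZeta g L f s := by
  unfold partialZeta
  rw [Finset.union_insert, ← Finset.insert_union, Finset.insert_eq_self.2 hx]

/-- Split the sum by whether `x` is a vertex of `t`: the faces avoiding `x` are those counted at `s`
for `L`, and the faces containing `x` lie above `s'` and are those counted there. -/
lemma partialZeta_insert_of_insert {L : Finset X} {x : X} (hxL : x ∉ L) (f : M → ℂ) {s s' : M}
    (hx : x ∉ g s) (hs' : g s' = insert x (g s)) :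
    partialZeta g (insert x L) f s = partialZeta g L f s + partialZeta g L f s' := by
  classical
  unfold partialZeta
  rw [← Finset.sum_filter_add_sum_filter_not _ (fun t => x ∉ g t)]
  congr 1
  · refine Finset.sum_congr ?_ fun _ _ => rfl
    ext t
    simp only [Finset.mem_filter, Finset.mem_univ, true_and]
    constructor
    · rintro ⟨⟨h₁, h₂⟩, h₃⟩
      rw [Finset.union_insert, Finset.subset_insert_iff_of_notMem h₃] at h₂
      exact ⟨h₁, h₂⟩
    · rintro ⟨h₁, h₂⟩
      refine ⟨⟨h₁, h₂.trans ?_⟩, fun h => ?_⟩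
      · gcongr
        exact Finset.subset_insert x L
      · have := h₂ h
        simp [hx, hxL] at this
  · refine Finset.sum_congr ?_ fun _ _ => rfl
    ext t
    simp only [Finset.mem_filter, Finset.mem_univ, true_and, not_not, hs', Finset.insert_union,
      Finset.union_insert, ← g.le_iff_le]
    rw [Finset.insert_subset_iff]
    tauto

/-- By downward closure, a face `t ≥ s` containing `x` would make `insert x (g s)` a face, so no new
terms appear. -/
lemma partialZeta_insert_of_not_exists {L : Finset X} {x : X}
    (hg : ∀ t G, G ⊆ g t → ∃ s, g s = G) (f : M → ℂ) {s : M}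
    (hs : ¬ ∃ s', g s' = insert x (g s)) :
    partialZeta g (insert x L) f s = partialZeta g L f s := by
  classical
  unfold partialZeta
  refine Finset.sum_congr ?_ fun _ _ => rfl
  ext t
  simp only [Finset.mem_filter, Finset.mem_univ, true_and]
  refine and_congr_right fun h => ?_
  have hxt : x ∉ g t := fun hxt =>
    hs (hg t _ (Finset.insert_subset hxt (g.le_iff_le.2 h)))
  rw [Finset.union_insert, Finset.subset_insert_iff_of_notMem hxt]

open Classical in
/-- The elements which can be extended by the vertex `x`. -/
def extendable (x : X) : Finset M :=
  Finset.univ.filter fun s => x ∉ g s ∧ ∃ s', g s' = insert x (g s)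

/-- An extension already contains `x`, so it is not itself extendable by `x`; this is the
disjointness of sources and targets that `add_mul_on` requires. -/
lemma exists_extension (x : X) :
    ∃ ext : M → M, ∀ s ∈ extendable g x, g (ext s) = insert x (g s) ∧ ext s ∉ extendable g x := by
  classical
  have h : ∀ s, ∃ s', s ∈ extendable g x → g s' = insert x (g s) := by
    intro s
    by_cases hs : s ∈ extendable g x
    · obtain ⟨s', hs'⟩ := (Finset.mem_filter.1 hs).2.2
      exact ⟨s', fun _ => hs'⟩
    · exact ⟨s, fun h => absurd h hs⟩
  choose ext hext using h
  refine ⟨ext, fun s hs => ⟨hext s hs, fun h => (Finset.mem_filter.1 h).2.1 ?_⟩⟩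
  rw [hext s hs]
  exact Finset.mem_insert_self _ _

lemma partialZeta_insert_of_notMem_extendable {L : Finset X} {x : X}
    (hg : ∀ t G, G ⊆ g t → ∃ s, g s = G) (f : M → ℂ) {s : M} (hs : s ∉ extendable g x) :
    partialZeta g (insert x L) f s = partialZeta g L f s := by
  by_cases hx : x ∈ g s
  · exact partialZeta_insert_of_mem g f hx
  · exact partialZeta_insert_of_not_exists g hg f fun h => hs (by simp [extendable, hx, h])

variable {Φ Y : Type} {inp : Φ → Y → ℂ}

lemma isLinComputable_partialZeta (hg : ∀ t G, G ⊆ g t → ∃ s, g s = G) (f : Φ → M → ℂ)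
    {m : ℕ} (h : IsLinComputable m inp f) (L : Finset X) :
    IsLinComputable (m + 2 * (L.card * Fintype.card M)) inp fun φ => partialZeta g L (f φ) := by
  induction L using Finset.induction_on with
  | empty => simpa [partialZeta_empty] using h
  | insert x L hx ih =>
    obtain ⟨ext, hext⟩ := exists_extension g x
    have h' := (ih.add_mul_on 1 (extendable g x) ext fun s hs => (hext s hs).2).mono
      (m' := m + 2 * ((insert x L).card * Fintype.card M)) (by
        rw [Finset.card_insert_of_notMem hx]
        have := Finset.card_le_univ (extendable g x)
        linarith)
    convert h' using 3 with φ s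
    by_cases hs : s ∈ extendable g x
    · rw [if_pos hs, one_mul]
      exact partialZeta_insert_of_insert g hx _ (Finset.mem_filter.1 hs).2.1 (hext s hs).1
    · rw [if_neg hs]
      exact partialZeta_insert_of_notMem_extendable g hg _ hs

/-- Each pass is reversible: the sources keep their values during the pass for `x`, so subtracting
them from the targets restores the previous state. -/
lemma isLinComputable_of_partialZeta (hg : ∀ t G, G ⊆ g t → ∃ s, g s = G) (f : Φ → M → ℂ)
    (L : Finset X) {m : ℕ} (h : IsLinComputable m inp fun φ => partialZeta g L (f φ)) :
    IsLinComputable (m + 2 * (L.card * Fintype.card M)) inp f := by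
  -- The vertex added last is undone first, so its cost is absorbed into `m` before the induction
  -- hypothesis applies.
  induction L using Finset.induction_on generalizing m with
  | empty => simpa [partialZeta_empty] using h
  | insert x L hx ih =>
    obtain ⟨ext, hext⟩ := exists_extension g x
    have h' := h.add_mul_on (-1) (extendable g x) ext fun s hs => (hext s hs).2
    refine (ih (m := m + 2 * (extendable g x).card) ?_).mono ?_
    · convert h' using 3 with φ s
      by_cases hs : s ∈ extendable g x
      · rw [if_pos hs, partialZeta_insert_of_insert g hx _ (Finset.mem_filter.1 hs).2.1
          (hext s hs).1, partialZeta_insert_of_notMem_extendable g hg _ (hext s hs).2]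
        ring
      · rw [if_neg hs, partialZeta_insert_of_notMem_extendable g hg _ hs]
    · rw [Finset.card_insert_of_notMem hx]
      have := Finset.card_le_univ (extendable g x)
      linarith

lemma isLinComputable_zetaTransform [Fintype X] (hg : ∀ t G, G ⊆ g t → ∃ s, g s = G)
    (f : Φ → M → ℂ) (h : IsLinComputable 0 inp f) :
    IsLinComputable (2 * (Fintype.card X * Fintype.card M)) inp fun φ => zetaTransform (f φ) := by
  simpa [partialZeta_univ] using isLinComputable_partialZeta g hg f h Finset.univ

lemma isLinComputable_of_zetaTransform [Fintype X] (hg : ∀ t G, G ⊆ g t → ∃ s, g s = G)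
    (f : Φ → M → ℂ) (h : IsLinComputable 0 inp fun φ => zetaTransform (f φ)) :
    IsLinComputable (2 * (Fintype.card X * Fintype.card M)) inp f := by
  simpa using isLinComputable_of_partialZeta g hg f Finset.univ (m := 0)
    (by simpa [partialZeta_univ] using h)

end FastZeta

/-! ### Möbius inversion -/

section Moebius

variable {M : Type} [PartialOrder M] [Fintype M] [LocallyFiniteOrder M]

/-- The dual Möbius inversion formula over a finite partial order. -/
lemma moebiusTransform_zetaTransform (f : M → ℂ) : moebiusTransform (zetaTransform f) = f := by
  classical
  ext s
  calc moebiusTransform (zetaTransform f) s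
      = ∑ t, ∑ u, if s ≤ t ∧ t ≤ u then IncidenceAlgebra.mu ℂ s t * f u else 0 := by
        simp only [moebiusTransform, zetaTransform, Finset.sum_filter, Finset.mul_sum]
        refine Finset.sum_congr rfl fun t _ => ?_
        split_ifs with h
        · simp [h]
        · simp [h]
    _ = ∑ u, (∑ t ∈ Finset.Icc s u, IncidenceAlgebra.mu ℂ s t) * f u := by
        rw [Finset.sum_comm]
        refine Finset.sum_congr rfl fun u _ => ?_
        rw [Finset.sum_mul, ← Finset.sum_filter]
        refine Finset.sum_congr ?_ fun _ _ => rfl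
        ext t
        simp
    _ = f s := by simp [IncidenceAlgebra.sum_Icc_mu_right]

/-- Möbius inversion gives a left inverse, and an injective endomorphism of a finite-dimensional
space is surjective. -/
lemma zetaTransform_bijective : Function.Bijective (zetaTransform : (M → ℂ) → M → ℂ) := by
  have hinj : Function.Injective (zetaTransform : (M → ℂ) → M → ℂ) :=
    Function.LeftInverse.injective moebiusTransform_zetaTransform
  let z : (M → ℂ) →ₗ[ℂ] (M → ℂ) :=
    { toFun := zetaTransform
      map_add' := fun f g => by ext; simp [zetaTransform, Finset.sum_add_distrib]
      map_smul' := fun c f => by ext; simp [zetaTransform, Finset.mul_sum] }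
  exact ⟨hinj, (LinearMap.injective_iff_surjective (f := z)).1 hinj⟩

end Moebius


/-! ### Complete sets of irreducible representations from a bijective Fourier transform -/

section CompleteIrreps

variable {A : Type} [Ring A] [Algebra ℂ A] {I : Type} {ι : I → Type} [∀ i, Fintype (ι i)]
  [∀ i, DecidableEq (ι i)] {Y : ∀ i, A →ₐ[ℂ] Matrix (ι i) (ι i) ℂ}

/-- A bijective Fourier transform as an isomorphism of algebras. -/
def fourierAlgEquiv (h : Function.Bijective (fourierTransform Y)) :
    A ≃ₐ[ℂ] ((i : I) → Matrix (ι i) (ι i) ℂ) :=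
  AlgEquiv.ofBijective (AlgHom.pi Y) <| by
    refine ⟨fun x y hxy => h.1 ?_, fun M => ?_⟩
    · ext p
      exact congrFun (congrFun (congrFun hxy p.1) p.2.1) p.2.2
    · obtain ⟨x, hx⟩ := h.2 fun p => M p.1 p.2.1 p.2.2
      refine ⟨x, ?_⟩
      ext i a b
      exact congrFun hx ⟨i, a, b⟩

lemma fourierAlgEquiv_apply (h : Function.Bijective (fourierTransform Y)) (x : A) (i : I) :
    fourierAlgEquiv h x i = Y i x := rfl

lemma apply_fourierAlgEquiv_symm (h : Function.Bijective (fourierTransform Y))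
    (M : (i : I) → Matrix (ι i) (ι i) ℂ) (i : I) : Y i ((fourierAlgEquiv h).symm M) = M i := by
  rw [← fourierAlgEquiv_apply h, AlgEquiv.apply_symm_apply]

variable [DecidableEq I]

lemma mul_fourierAlgEquiv_symm_single (h : Function.Bijective (fourierTransform Y)) (x : A)
    (k : I) (M : Matrix (ι k) (ι k) ℂ) :
    x * (fourierAlgEquiv h).symm (Pi.single k M) =
      (fourierAlgEquiv h).symm (Pi.single k (Y k x * M)) := by
  apply (fourierAlgEquiv h).injective
  rw [map_mul, AlgEquiv.apply_symm_apply, AlgEquiv.apply_symm_apply]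
  ext1 i
  by_cases hi : i = k
  · subst hi
    simp [fourierAlgEquiv_apply]
  · simp [hi]

lemma one_eq_sum_vecMulVec (κ : Type) [Fintype κ] [DecidableEq κ] :
    (1 : Matrix κ κ ℂ) = ∑ a, Matrix.vecMulVec (Pi.single a 1) (Pi.single a 1) := by
  ext i j
  simp [Matrix.sum_apply, Matrix.vecMulVec_apply, Matrix.one_apply, Pi.single_apply]

lemma isIrreducibleRep_of_surjective {κ : Type} [Fintype κ] [DecidableEq κ] [Nonempty κ]
    (ρ : A →ₐ[ℂ] Matrix κ κ ℂ) (h : Function.Surjective ρ) : IsIrreducibleRep ρ := by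
  refine ⟨inferInstance, fun W hW => or_iff_not_imp_left.2 fun hne => ?_⟩
  obtain ⟨w, hw, hw0⟩ := W.ne_bot_iff.1 hne
  obtain ⟨a, ha⟩ := Function.ne_iff.1 hw0
  rw [eq_top_iff]
  intro v _
  -- This rank-one matrix reads off coordinate `a` of `w`, normalises it to `1` and returns `v`.
  obtain ⟨x, hx⟩ := h (Matrix.vecMulVec v (Pi.single a (w a)⁻¹))
  have := hW x w hw
  rwa [hx, Matrix.vecMulVec_mulVec, single_dotProduct, inv_mul_cancel₀ ha, MulOpposite.op_one,
    one_smul] at this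

/-- If `ρ` is irreducible and some element supported at `k` acts nontrivially, then `ρ` is
equivalent to `Y k`. -/
lemma equivalentReps_of_mulVec_ne_zero (h : Function.Bijective (fourierTransform Y))
    {κ : Type} [Fintype κ] [DecidableEq κ] {ρ : A →ₐ[ℂ] Matrix κ κ ℂ} (hρ : IsIrreducibleRep ρ)
    {k : I} (hk : IsIrreducibleRep (Y k)) (u₀ φ : ι k → ℂ) (v : κ → ℂ)
    (hv : (ρ ((fourierAlgEquiv h).symm (Pi.single k (Matrix.vecMulVec u₀ φ)))).mulVec v ≠ 0) :
    EquivalentReps ρ (Y k) := by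
  -- Matrices `u φᵀ` with `φ` fixed form a left ideal isomorphic to the module of `Y k`. Acting on
  -- `v` with this ideal gives an intertwiner `T`, nonzero at `u₀`, and Schur's lemma makes it an
  -- isomorphism.
  let T : (ι k → ℂ) →ₗ[ℂ] (κ → ℂ) :=
    { toFun := fun u =>
        (ρ ((fourierAlgEquiv h).symm (Pi.single k (Matrix.vecMulVec u φ)))).mulVec v
      map_add' := fun x y => by
        simp [Matrix.add_vecMulVec, Pi.single_add, Matrix.add_mulVec]
      map_smul' := fun c x => by
        simp [Matrix.smul_vecMulVec, Pi.single_smul, Matrix.smul_mulVec] }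
  have hT : ∀ x u, T ((Y k x).mulVec u) = (ρ x).mulVec (T u) := by
    intro x u
    change (ρ _).mulVec v = (ρ x).mulVec ((ρ _).mulVec v)
    rw [Matrix.mulVec_mulVec, ← map_mul, mul_fourierAlgEquiv_symm_single, Matrix.mul_vecMulVec]
  have hinj : LinearMap.ker T = ⊥ := by
    refine (hk.2 (LinearMap.ker T) fun x w hw => ?_).resolve_right fun htop => hv ?_
    · rw [LinearMap.mem_ker] at hw ⊢
      rw [hT, hw, Matrix.mulVec_zero]
    · have : u₀ ∈ LinearMap.ker T := htop ▸ Submodule.mem_top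
      exact this
  have hsurj : LinearMap.range T = ⊤ := by
    refine (hρ.2 (LinearMap.range T) ?_).resolve_left fun hbot => hv ?_
    · rintro x _ ⟨u, rfl⟩
      exact ⟨(Y k x).mulVec u, hT x u⟩
    · have : T u₀ ∈ LinearMap.range T := ⟨u₀, rfl⟩
      rw [hbot] at this
      exact this
  let E := LinearEquiv.ofBijective T ⟨LinearMap.ker_eq_bot.1 hinj, LinearMap.range_eq_top.1 hsurj⟩
  refine ⟨E.symm, fun x w => ?_⟩
  rw [LinearEquiv.symm_apply_eq]
  change _ = T _
  rw [hT]
  congr 1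
  exact (E.apply_symm_apply w).symm

/-- Each block projection is surjective, hence irreducible. The identity of block `i` acts as `1`
under `Y i` and as `0` under `Y j`, which excludes equivalence. An irreducible `ρ` equivalent to no
`Y k` would kill every rank-one element of every block, hence their sum over the diagonal ones,
which is `1`. -/
lemma isCompleteIrreps_of_bijective [Fintype I] [∀ i, Nonempty (ι i)]
    (h : Function.Bijective (fourierTransform Y)) : IsCompleteIrreps Y := by
  have hirr : ∀ i, IsIrreducibleRep (Y i) := fun i =>
    isIrreducibleRep_of_surjective _ fun M =>
      ⟨(fourierAlgEquiv h).symm (Pi.single i M), by simp [apply_fourierAlgEquiv_symm]⟩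
  refine ⟨hirr, fun i j hij hE => ?_, fun d ρ hρ => ?_⟩
  · obtain ⟨T, hT⟩ := hE
    obtain ⟨a⟩ := (hirr i).1
    have := hT ((fourierAlgEquiv h).symm (Pi.single i 1)) (Pi.single a 1)
    simp only [apply_fourierAlgEquiv_symm, Pi.single_eq_same, Pi.single_eq_of_ne hij.symm,
      Matrix.one_mulVec, Matrix.zero_mulVec, LinearEquiv.map_eq_zero_iff] at this
    simpa using congrFun this a
  · by_contra! hne
    obtain ⟨b⟩ := hρ.1
    have hzero : ∀ v, (ρ 1).mulVec v = 0 := by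
      intro v
      have h1 : (1 : A) = ∑ k, ∑ a, (fourierAlgEquiv h).symm
          (Pi.single k (Matrix.vecMulVec (Pi.single a 1) (Pi.single a 1))) := by
        apply (fourierAlgEquiv h).injective
        simp only [map_one, map_sum, AlgEquiv.apply_symm_apply]
        rw [← Finset.univ_sum_single (1 : (i : I) → Matrix (ι i) (ι i) ℂ)]
        refine Finset.sum_congr rfl fun k _ => ?_
        rw [Pi.one_apply, one_eq_sum_vecMulVec]
        exact map_sum (AddMonoidHom.single (fun i => Matrix (ι i) (ι i) ℂ) k) _ _
      rw [h1]
      simp only [map_sum, Matrix.sum_mulVec]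
      refine Finset.sum_eq_zero fun k _ => Finset.sum_eq_zero fun a _ => ?_
      by_contra hv
      exact hne k (equivalentReps_of_mulVec_ne_zero h hρ (hirr k) _ _ _ hv)
    have := congrFun (hzero (Pi.single b 1)) b
    simp at this

end CompleteIrreps


namespace PlanarRook

variable {n : ℕ}

/-! ### Planar rook elements as strict chains in the grid -/

lemma le_def {s t : PlanarRook n} : s ≤ t ↔ ∀ i a, s.1 i = some a → t.1 i = some a := Iff.rfl

lemma lt_iff_lt {s : PlanarRook n} {i j a b : Fin n} (hi : s.1 i = some a) (hj : s.1 j = some b) :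
    i < j ↔ a < b :=
  ⟨fun h => s.2 i j a b h hi hj, fun h => s⁻¹.2 a b i j h (inv_apply.2 hi) (inv_apply.2 hj)⟩

/-- A strict chain in the grid is the graph of an element of the planar rook monoid. -/
lemma exists_of_rel (R : Fin n → Fin n → Prop)
    (h : ∀ i j a b, R i a → R j b → (i < j ↔ a < b)) :
    ∃ s : PlanarRook n, ∀ i a, s.1 i = some a ↔ R i a := by
  classical
  -- Applied with equal rows, `h` turns a strict inequality between two values into `i < i`; equal
  -- columns are treated symmetrically.
  have h₁ : ∀ i a b, R i a → R i b → a = b := fun i a b ha hb =>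
    le_antisymm (not_lt.1 fun hlt => lt_irrefl i ((h i i b a hb ha).2 hlt))
      (not_lt.1 fun hlt => lt_irrefl i ((h i i a b ha hb).2 hlt))
  have h₂ : ∀ i j a, R i a → R j a → i = j := fun i j a hi hj =>
    le_antisymm (not_lt.1 fun hlt => lt_irrefl a ((h j i a a hj hi).1 hlt))
      (not_lt.1 fun hlt => lt_irrefl a ((h i j a a hi hj).1 hlt))
  have hf : ∀ i a, (if h : ∃ a, R i a then some h.choose else none) = some a ↔ R i a := by
    intro i a
    split_ifs with hi
    · rw [Option.some.injEq]
      exact ⟨fun e => e ▸ hi.choose_spec, fun e => h₁ i _ _ hi.choose_spec e⟩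
    · exact ⟨fun e => by simp at e, fun e => absurd ⟨a, e⟩ hi⟩
  have hg : ∀ a i, (if h : ∃ i, R i a then some h.choose else none) = some i ↔ R i a := by
    intro a i
    split_ifs with hi
    · rw [Option.some.injEq]
      exact ⟨fun e => e ▸ hi.choose_spec, fun e => h₂ _ _ _ hi.choose_spec e⟩
    · exact ⟨fun e => by simp at e, fun e => absurd ⟨i, e⟩ hi⟩
  refine ⟨⟨⟨fun i => if h : ∃ a, R i a then some h.choose else none,
    fun a => if h : ∃ i, R i a then some h.choose else none, fun i a => ?_⟩, ?_⟩, fun i a => hf i a⟩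
  · exact (hg a i).trans (hf i a).symm
  · intro i j a b hij hi hj
    exact (h i j a b ((hf i a).1 hi) ((hf j b).1 hj)).1 hij

/-- The graph of a planar rook element; the order becomes inclusion. -/
def graph : PlanarRook n ↪o Finset (Fin n × Fin n) :=
  OrderEmbedding.ofMapLEIff (fun s => Finset.univ.filter fun p => s.1 p.1 = some p.2) <| by
    intro s t
    rw [le_def]
    constructor
    · intro h i a hi
      exact (Finset.mem_filter.1 (h (Finset.mem_filter.2 ⟨Finset.mem_univ (i, a), hi⟩))).2
    · intro h p hp
      exact Finset.mem_filter.2 ⟨Finset.mem_univ p, h _ _ (Finset.mem_filter.1 hp).2⟩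

lemma mem_graph {s : PlanarRook n} {p : Fin n × Fin n} : p ∈ graph s ↔ s.1 p.1 = some p.2 := by
  simp [graph]

/-- The strict-chain condition concerns pairs of points only and so passes to subsets. This is the
simplicial complex property behind the lattice structure and the fast transforms. -/
lemma exists_graph_eq (t : PlanarRook n) (G : Finset (Fin n × Fin n)) (hG : G ⊆ graph t) :
    ∃ s, graph s = G := by
  obtain ⟨s, hs⟩ := exists_of_rel (fun i a => (i, a) ∈ G) fun i j a b hi hj =>
    lt_iff_lt (mem_graph.1 (hG hi)) (mem_graph.1 (hG hj))
  refine ⟨s, ?_⟩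
  ext p
  rw [mem_graph, hs]

lemma exists_graph_singleton (p : Fin n × Fin n) : ∃ s : PlanarRook n, graph s = {p} := by
  obtain ⟨s, hs⟩ := exists_of_rel (fun i a => (i, a) = p) fun i j a b hi hj => by
    cases hi
    cases hj
    simp
  refine ⟨s, ?_⟩
  ext q
  rw [mem_graph, hs, Finset.mem_singleton]

lemma card_graph (s : PlanarRook n) : (graph s).card = s.rank := by
  refine Finset.card_bij (fun p _ => p.1) ?_ ?_ ?_
  · intro p hp
    simp [mem_graph.1 hp]
  · intro p hp q hq hpq
    have h₁ := mem_graph.1 hp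
    rw [hpq, mem_graph.1 hq] at h₁
    exact Prod.ext hpq (Option.some.inj h₁).symm
  · intro i hi
    obtain ⟨a, ha⟩ := Option.isSome_iff_exists.1 (Finset.mem_filter.1 hi).2
    exact ⟨(i, a), mem_graph.2 ha, rfl⟩

/-! ### Domains and ranges -/

/-- The domain of a planar rook element as a set. -/
def domSet (s : PlanarRook n) : Finset (Fin n) :=
  Finset.univ.filter fun i => (s.1 i).isSome

lemma mem_domSet {s : PlanarRook n} {i : Fin n} : i ∈ s.domSet ↔ ∃ a, s.1 i = some a := by
  simp [domSet, Option.isSome_iff_exists]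

lemma mem_domSet_inv {s : PlanarRook n} {a : Fin n} : a ∈ s⁻¹.domSet ↔ ∃ i, s.1 i = some a := by
  simp [mem_domSet, inv_apply]

lemma card_domSet (s : PlanarRook n) : s.domSet.card = s.rank := rfl

lemma dom_apply' {s : PlanarRook n} {i a : Fin n} :
    (s⁻¹ * s).1 i = some a ↔ i = a ∧ i ∈ s.domSet := by
  rw [dom_apply]
  simp [domSet]

lemma dom_eq_iff {s t : PlanarRook n} : s⁻¹ * s = t⁻¹ * t ↔ s.domSet = t.domSet := by
  constructor
  · intro h
    ext i
    have h₁ := dom_apply' (s := s) (i := i) (a := i)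
    rw [h, dom_apply'] at h₁
    simpa using h₁.symm
  · intro h
    refine ext' fun i a => ?_
    rw [dom_apply', dom_apply', h]

lemma ran_eq_iff {s t : PlanarRook n} : s * s⁻¹ = t * t⁻¹ ↔ s⁻¹.domSet = t⁻¹.domSet :=
  dom_eq_iff (s := s⁻¹) (t := t⁻¹)

/-- A planar rook element is the order isomorphism from its domain to its range. -/
lemma apply_eq_some_iff {s : PlanarRook n} {k : ℕ} {A B : Finset (Fin n)} (hA : A.card = k)
    (hB : B.card = k) (hsA : s.domSet = A) (hsB : s⁻¹.domSet = B) {i a : Fin n} :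
    s.1 i = some a ↔ ∃ j, A.orderEmbOfFin hA j = i ∧ B.orderEmbOfFin hB j = a := by
  have hex : ∀ j, ∃ a, s.1 (A.orderEmbOfFin hA j) = some a := fun j =>
    mem_domSet.1 (hsA ▸ A.orderEmbOfFin_mem hA j)
  choose f hf using hex
  -- Following the increasing enumeration of `A` by `s` gives a strictly increasing map into `B`,
  -- and `B` has only one increasing enumeration.
  have hfB : f = B.orderEmbOfFin hB :=
    Finset.orderEmbOfFin_unique hB (fun j => hsB ▸ mem_domSet_inv.2 ⟨_, hf j⟩)
      fun j j' hj => (lt_iff_lt (hf j) (hf j')).1 ((A.orderEmbOfFin hA).strictMono hj)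
  constructor
  · intro hi
    have : i ∈ Set.range (A.orderEmbOfFin hA) := by
      rw [Finset.range_orderEmbOfFin]
      exact hsA ▸ mem_domSet.2 ⟨a, hi⟩
    obtain ⟨j, rfl⟩ := this
    rw [hf j] at hi
    exact ⟨j, rfl, hfB ▸ Option.some.inj hi⟩
  · rintro ⟨j, rfl, rfl⟩
    rw [hf j, hfB]

/-- A planar rook element is determined by its domain and its range. -/
lemma eq_of_dom_eq_of_ran_eq {s t : PlanarRook n} (hd : s⁻¹ * s = t⁻¹ * t)
    (hr : s * s⁻¹ = t * t⁻¹) : s = t := by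
  rw [dom_eq_iff] at hd
  rw [ran_eq_iff] at hr
  refine ext' fun i a => ?_
  rw [apply_eq_some_iff t.card_domSet (t⁻¹.card_domSet.trans t.rank_inv) hd hr,
    apply_eq_some_iff t.card_domSet (t⁻¹.card_domSet.trans t.rank_inv) rfl rfl]

lemma exists_domSet_eq {A B : Finset (Fin n)} (h : A.card = B.card) :
    ∃ s : PlanarRook n, s.domSet = A ∧ s⁻¹.domSet = B := by
  obtain ⟨s, hs⟩ := exists_of_rel
    (fun i a => ∃ j, A.orderEmbOfFin h j = i ∧ B.orderEmbOfFin rfl j = a) (by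
      rintro _ _ _ _ ⟨j, rfl, rfl⟩ ⟨j', rfl, rfl⟩
      simp)
  refine ⟨s, ?_, ?_⟩
  · ext i
    rw [mem_domSet]
    constructor
    · rintro ⟨a, ha⟩
      obtain ⟨j, rfl, _⟩ := (hs i a).1 ha
      exact A.orderEmbOfFin_mem h j
    · intro hi
      obtain ⟨j, rfl⟩ : i ∈ Set.range (A.orderEmbOfFin h) := by rwa [Finset.range_orderEmbOfFin]
      exact ⟨_, (hs _ _).2 ⟨j, rfl, rfl⟩⟩
  · ext a
    rw [mem_domSet_inv]
    constructor
    · rintro ⟨i, hi⟩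
      obtain ⟨j, _, rfl⟩ := (hs i a).1 hi
      exact B.orderEmbOfFin_mem rfl j
    · intro ha
      obtain ⟨j, rfl⟩ : a ∈ Set.range (B.orderEmbOfFin rfl) := by rwa [Finset.range_orderEmbOfFin]
      exact ⟨_, (hs _ _).2 ⟨j, rfl, rfl⟩⟩

lemma inv_eq_of_isIdempotentElem {e : PlanarRook n} (he : IsIdempotentElem e) : e⁻¹ = e :=
  (inv_unique (by rw [he.eq, he.eq]) (by rw [he.eq, he.eq])).symm

lemma dom_of_isIdempotentElem {e : PlanarRook n} (he : IsIdempotentElem e) : e⁻¹ * e = e := by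
  rw [inv_eq_of_isIdempotentElem he, he.eq]

lemma ran_of_isIdempotentElem {e : PlanarRook n} (he : IsIdempotentElem e) : e * e⁻¹ = e := by
  rw [inv_eq_of_isIdempotentElem he, he.eq]

lemma exists_dom_eq_ran_eq {a b : PlanarRook n} (ha : IsIdempotentElem a)
    (hb : IsIdempotentElem b) (h : a.rank = b.rank) :
    ∃ x : PlanarRook n, x⁻¹ * x = a ∧ x * x⁻¹ = b := by
  obtain ⟨x, hxa, hxb⟩ := exists_domSet_eq (A := a.domSet) (B := b⁻¹.domSet)
    (h.trans b.rank_inv.symm)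
  exact ⟨x, (dom_eq_iff.2 hxa).trans (dom_of_isIdempotentElem ha),
    (ran_eq_iff.2 hxb).trans (ran_of_isIdempotentElem hb)⟩

lemma dRel_iff (s t : PlanarRook n) : DRel s t ↔ s.rank = t.rank := by
  constructor
  · rintro ⟨x, hx, hx'⟩
    rw [← rank_ran s, ← rank_ran t, ← hx, ← hx', rank_dom, rank_ran]
  · intro h
    exact exists_dom_eq_ran_eq (isIdempotentElem_ran s) (isIdempotentElem_ran t)
      (by rw [rank_ran, rank_ran, h])

lemma maxSubgroup_eq {e : PlanarRook n} (he : IsIdempotentElem e) : maxSubgroup e = {e} := by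
  ext s
  rw [Set.mem_singleton_iff]
  constructor
  · rintro ⟨h₁, h₂⟩
    exact eq_of_dom_eq_of_ran_eq (h₁.trans (dom_of_isIdempotentElem he).symm)
      (h₂.trans (ran_of_isIdempotentElem he).symm)
  · rintro rfl
    exact ⟨dom_of_isIdempotentElem he, ran_of_isIdempotentElem he⟩

lemma mul_inv_rev (s t : PlanarRook n) : (s * t)⁻¹ = t⁻¹ * s⁻¹ := by
  refine ext' fun i a => ?_
  simp only [inv_apply, mul_apply]
  exact exists_congr fun b => and_comm

lemma dom_mul {v u : PlanarRook n} (h : v⁻¹ * v = u * u⁻¹) : (v * u)⁻¹ * (v * u) = u⁻¹ * u := by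
  rw [mul_inv_rev, mul_assoc, ← mul_assoc v⁻¹, h, mul_inv_mul]

lemma ran_mul {v u : PlanarRook n} (h : v⁻¹ * v = u * u⁻¹) : v * u * (v * u)⁻¹ = v * v⁻¹ := by
  rw [mul_inv_rev, mul_assoc, ← mul_assoc u, ← h, ← mul_assoc, ← mul_assoc, mul_inv_mul]

/-! ### Lattice structure -/

lemma isMeetSemilatticeOrder : IsMeetSemilatticeOrder (PlanarRook n) := by
  intro a b
  obtain ⟨c, hc⟩ := exists_graph_eq a (graph a ∩ graph b) Finset.inter_subset_left
  refine ⟨c, ?_, fun d hd => ?_⟩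
  · rintro x (rfl | rfl) <;> rw [← graph.le_iff_le, hc]
    · exact Finset.inter_subset_left
    · exact Finset.inter_subset_right
  · rw [← graph.le_iff_le, hc]
    exact Finset.subset_inter (graph.le_iff_le.2 (hd (by simp))) (graph.le_iff_le.2 (hd (by simp)))

lemma exists_isLUB {a b u : PlanarRook n} (ha : a ≤ u) (hb : b ≤ u) :
    ∃ c, IsLUB {a, b} c := by
  obtain ⟨c, hc⟩ := exists_graph_eq u (graph a ∪ graph b)
    (Finset.union_subset (graph.le_iff_le.2 ha) (graph.le_iff_le.2 hb))
  refine ⟨c, ?_, fun d hd => ?_⟩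
  · rintro x (rfl | rfl) <;> rw [← graph.le_iff_le, hc]
    · exact Finset.subset_union_left
    · exact Finset.subset_union_right
  · rw [← graph.le_iff_le, hc]
    exact Finset.union_subset (graph.le_iff_le.2 (hd (by simp))) (graph.le_iff_le.2 (hd (by simp)))

/-- Deleting a point from the graph gives a covered element, and different points give different
ones; uniqueness therefore means that the graph is a single point. -/
lemma existsUnique_covBy_iff (s : PlanarRook n) : (∃! x, x ⋖ s) ↔ s.rank = 1 := by
  have herase : ∀ p ∈ graph s, ∃ c, graph c = (graph s).erase p ∧ c ⋖ s := by
    intro p hp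
    obtain ⟨c, hc⟩ := exists_graph_eq s _ (Finset.erase_subset p (graph s))
    refine ⟨c, hc, CovBy.of_image graph ?_⟩
    rw [hc]
    exact Finset.erase_covBy hp
  constructor
  · rintro ⟨x, hx, hu⟩
    obtain ⟨p, hp, hpx⟩ := Finset.exists_of_ssubset (graph.lt_iff_lt.2 hx.lt)
    rw [← card_graph, Finset.card_eq_one]
    refine ⟨p, Finset.eq_singleton_iff_unique_mem.2 ⟨hp, fun q hq => ?_⟩⟩
    obtain ⟨c, hc, hcs⟩ := herase p hp
    obtain ⟨d, hd, hds⟩ := herase q hq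
    rw [hu c hcs, ← hu d hds, hd] at hc
    by_contra hne
    have : q ∈ (graph s).erase p := Finset.mem_erase.2 ⟨hne, hq⟩
    rw [← hc] at this
    simp at this
  · intro h
    rw [← card_graph, Finset.card_eq_one] at h
    obtain ⟨p, hp⟩ := h
    obtain ⟨c, hc, hcs⟩ := herase p (by simp [hp])
    refine ⟨c, hcs, fun y hy => graph.injective ?_⟩
    have hlt := graph.lt_iff_lt.2 hy.lt
    rw [hp] at hlt hc
    rw [hc, Finset.ssubset_singleton_iff.1 hlt]
    simp

lemma ncard_rank_one : {s : PlanarRook n | s.rank = 1}.ncard = n ^ 2 := by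
  choose pt hpt using exists_graph_singleton (n := n)
  have hinj : Function.Injective pt := fun p q h => by
    have := hpt p
    rw [h, hpt q] at this
    exact (Finset.singleton_injective this).symm
  have hrange : {s : PlanarRook n | s.rank = 1} = Set.range pt := by
    ext s
    rw [Set.mem_ofPred_eq, ← card_graph, Finset.card_eq_one]
    constructor
    · rintro ⟨p, hp⟩
      exact ⟨p, graph.injective ((hpt p).trans hp.symm)⟩
    · rintro ⟨p, rfl⟩
      exact ⟨p, hpt p⟩
  rw [hrange, ← Set.image_univ, Set.ncard_image_of_injective _ hinj, Set.ncard_univ]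
  simp [sq]

end PlanarRook

/-! ### The completion of a meet-semilattice -/

section LatticeCompletion

variable {M : Type} [PartialOrder M]

/-- The inclusion of an ordered set into its lattice completion. -/
def LatticeCompletion.of : M ↪o LatticeCompletion M where
  toFun s := ⟨s, fun h => absurd h (WithTop.coe_ne_top)⟩
  inj' _ _ h := WithTop.coe_injective (congrArg Subtype.val h)
  map_rel_iff' := WithTop.coe_le_coe

namespace LatticeCompletion

lemma eq_of_or_eq_top (x : LatticeCompletion M) : (∃ s, x = of s) ∨ x.1 = ⊤ := by
  rcases h : x.1 with _ | s
  · exact Or.inr rfl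
  · exact Or.inl ⟨s, Subtype.ext h⟩

lemma isLatticeOrder (hmeet : IsMeetSemilatticeOrder M)
    (hjoin : ∀ a b u : M, a ≤ u → b ≤ u → ∃ c, IsLUB {a, b} c) :
    IsLatticeOrder (LatticeCompletion M) := by
  have hle : ∀ x y : LatticeCompletion M, y.1 = ⊤ → x ≤ y := fun x y hy => by
    change x.1 ≤ y.1
    simp [hy]
  constructor
  · intro x y
    rcases eq_of_or_eq_top x with ⟨a, rfl⟩ | hx
    · rcases eq_of_or_eq_top y with ⟨b, rfl⟩ | hy
      · obtain ⟨c, hc⟩ := hmeet a b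
        refine ⟨of c, ?_, fun d hd => ?_⟩
        · rintro _ (rfl | rfl)
          · exact of.le_iff_le.2 (hc.1 (Set.mem_insert _ _))
          · exact of.le_iff_le.2 (hc.1 (Set.mem_insert_of_mem _ rfl))
        · have hda : d ≤ of a := hd (by simp)
          have hdb : d ≤ of b := hd (by simp)
          rcases eq_of_or_eq_top d with ⟨d, rfl⟩ | hd'
          · refine of.le_iff_le.2 (hc.2 ?_)
            rintro _ (rfl | rfl)
            · exact of.le_iff_le.1 hda
            · exact of.le_iff_le.1 hdb
          · change d.1 ≤ _ at hda
            rw [hd', top_le_iff] at hda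
            exact absurd hda WithTop.coe_ne_top
      · refine ⟨of a, ?_, fun d hd => hd (by simp)⟩
        rintro _ (rfl | rfl)
        · exact le_rfl
        · exact hle _ _ hy
    · refine ⟨y, ?_, fun d hd => hd (by simp)⟩
      rintro _ (rfl | rfl)
      · exact hle _ _ hx
      · exact le_rfl
  · intro x y
    by_cases htop : x.1 = ⊤ ∨ y.1 = ⊤
    · rcases htop with hx | hy
      · refine ⟨x, ?_, fun d hd => hd (by simp)⟩
        rintro _ (rfl | rfl)
        · exact le_rfl
        · exact hle _ _ hx
      · refine ⟨y, ?_, fun d hd => hd (by simp)⟩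
        rintro _ (rfl | rfl)
        · exact hle _ _ hy
        · exact le_rfl
    · rw [not_or] at htop
      obtain ⟨a, rfl⟩ := (eq_of_or_eq_top x).resolve_right htop.1
      obtain ⟨b, rfl⟩ := (eq_of_or_eq_top y).resolve_right htop.2
      by_cases hub : ∃ c, IsLUB {a, b} c
      · obtain ⟨c, hc⟩ := hub
        refine ⟨of c, ?_, fun d hd => ?_⟩
        · rintro _ (rfl | rfl)
          · exact of.le_iff_le.2 (hc.1 (Set.mem_insert _ _))
          · exact of.le_iff_le.2 (hc.1 (Set.mem_insert_of_mem _ rfl))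
        · rcases eq_of_or_eq_top d with ⟨d, rfl⟩ | hd'
          · refine of.le_iff_le.2 (hc.2 ?_)
            rintro _ (rfl | rfl)
            · exact of.le_iff_le.1 (hd (by simp))
            · exact of.le_iff_le.1 (hd (by simp))
          · exact hle _ _ hd'
      -- A pair without a join shows that `M` is no lattice, so the formal top exists. By `hjoin`
      -- the pair has no upper bound in `M`, so the top is its join.
      · refine ⟨⟨⊤, fun _ hlat => hub (hlat.2 a b)⟩, fun d _ => hle _ _ rfl, fun d hd => ?_⟩
        rcases eq_of_or_eq_top d with ⟨d, rfl⟩ | hd'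
        · exact absurd (hjoin a b d (of.le_iff_le.1 (hd (by simp))) (of.le_iff_le.1 (hd (by simp))))
            hub
        · exact hle _ _ hd'

lemma covBy_of_iff {x : LatticeCompletion M} {s : M} : x ⋖ of s ↔ ∃ t, x = of t ∧ t ⋖ s := by
  constructor
  · intro h
    rcases eq_of_or_eq_top x with ⟨t, rfl⟩ | hx
    · exact ⟨t, rfl, CovBy.of_image of h⟩
    · have := h.lt
      change x.1 < (of s).1 at this
      simp [hx] at this
  · rintro ⟨t, rfl, h⟩
    refine ⟨of.lt_iff_lt.2 h.lt, fun y hy hy' => ?_⟩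
    rcases eq_of_or_eq_top y with ⟨u, rfl⟩ | hy''
    · exact h.2 (of.lt_iff_lt.1 hy) (of.lt_iff_lt.1 hy')
    · change y.1 < (of s).1 at hy'
      simp [hy''] at hy'

lemma isJoinIrreducible_of_iff {s : M} : IsJoinIrreducible (of s) ↔ ∃! t, t ⋖ s := by
  unfold IsJoinIrreducible
  simp only [covBy_of_iff]
  constructor
  · rintro ⟨_, ⟨t, rfl, ht⟩, hu⟩
    exact ⟨t, ht, fun u hus => of.injective (hu _ ⟨u, rfl, hus⟩)⟩
  · rintro ⟨t, ht, hu⟩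
    refine ⟨of t, ⟨t, rfl, ht⟩, ?_⟩
    rintro _ ⟨u, rfl, hus⟩
    rw [hu u hus]

/-- A formal maximal element covers at least two elements. -/
lemma not_isJoinIrreducible_top [Finite M] (hmeet : IsMeetSemilatticeOrder M)
    (hjoin : ∀ a b u : M, a ≤ u → b ≤ u → ∃ c, IsLUB {a, b} c) {x : LatticeCompletion M}
    (hx : x.1 = ⊤) : ¬ IsJoinIrreducible x := by
  rintro ⟨m, hm, hu⟩
  have hcov : ∀ t : M, IsMax t → of t ⋖ x := by
    intro t ht
    refine ⟨?_, fun y hy hy' => ?_⟩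
    · change (of t).1 < x.1
      rw [hx]
      exact WithTop.coe_lt_top t
    · rcases eq_of_or_eq_top y with ⟨u, rfl⟩ | hy''
      · exact ht.not_lt (of.lt_iff_lt.1 hy)
      · change y.1 < x.1 at hy'
        rw [hy'', hx] at hy'
        exact lt_irrefl _ hy'
  -- If the top covered only one element, `M` would have a single maximal element. Every pair would
  -- then be bounded above and have a join, so `M` would be a lattice and no top would have been
  -- adjoined.
  refine x.2 hx ⟨hmeet, fun a b => ?_⟩
  obtain ⟨a', ha, ha'⟩ := Finite.exists_le_maximal (p := fun _ : M => True) (a := a) trivial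
  obtain ⟨b', hb, hb'⟩ := Finite.exists_le_maximal (p := fun _ : M => True) (a := b) trivial
  have h₁ := hu _ (hcov a' (maximal_true.1 ha'))
  have h₂ := hu _ (hcov b' (maximal_true.1 hb'))
  have : a' = b' := of.injective (h₁.trans h₂.symm)
  exact hjoin a b a' ha (this ▸ hb)

lemma setOf_isJoinIrreducible [Finite M] (hmeet : IsMeetSemilatticeOrder M)
    (hjoin : ∀ a b u : M, a ≤ u → b ≤ u → ∃ c, IsLUB {a, b} c) :
    {j : LatticeCompletion M | IsJoinIrreducible j} = of '' {s : M | ∃! t, t ⋖ s} := by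
  ext j
  rw [Set.mem_ofPred_eq]
  rcases eq_of_or_eq_top j with ⟨s, rfl⟩ | hj
  · rw [isJoinIrreducible_of_iff, of.injective.mem_set_image, Set.mem_ofPred_eq]
  · refine iff_of_false (not_isJoinIrreducible_top hmeet hjoin hj) ?_
    rintro ⟨s, _, rfl⟩
    exact WithTop.coe_ne_top hj

end LatticeCompletion

end LatticeCompletion


namespace PlanarRook

variable {n : ℕ}

/-! ### The representations -/

/-- Some restriction of `t` has domain `b` and range `a`. -/
def HasRestriction (t b a : PlanarRook n) : Prop :=
  ∃ s ≤ t, s⁻¹ * s = b ∧ s * s⁻¹ = a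

lemma hasRestriction_dom_ran_iff {s t : PlanarRook n} :
    HasRestriction t (s⁻¹ * s) (s * s⁻¹) ↔ s ≤ t := by
  refine ⟨?_, fun h => ⟨s, h, rfl, rfl⟩⟩
  rintro ⟨u, hu, hd, hr⟩
  rwa [← eq_of_dom_eq_of_ran_eq hd hr]

lemma eq_of_le_of_dom_eq {s u t : PlanarRook n} (hs : s ≤ t) (hu : u ≤ t)
    (h : s⁻¹ * s = u⁻¹ * u) : s = u := by
  rw [dom_eq_iff] at h
  have key : ∀ {s u : PlanarRook n}, s ≤ t → u ≤ t → s.domSet = u.domSet → s ≤ u := by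
    intro s u hs hu h i a hi
    change s.1 i = some a at hi
    obtain ⟨b, hb⟩ := mem_domSet.1 (h ▸ mem_domSet.2 ⟨a, hi⟩ : i ∈ u.domSet)
    have h₁ := le_def.1 hs i a hi
    rw [le_def.1 hu i b hb] at h₁
    change u.1 i = some a
    rw [hb, h₁]
  exact le_antisymm (key hs hu h) (key hu hs h.symm)

lemma HasRestriction.unique {t b a a' : PlanarRook n} (h : HasRestriction t b a)
    (h' : HasRestriction t b a') : a = a' := by
  obtain ⟨s, hs, hsb, rfl⟩ := h
  obtain ⟨u, hu, hub, rfl⟩ := h'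
  rw [eq_of_le_of_dom_eq hs hu (hsb.trans hub.symm)]

lemma HasRestriction.rank_eq {t b a : PlanarRook n} (h : HasRestriction t b a) :
    b.rank = a.rank := by
  obtain ⟨s, _, rfl, rfl⟩ := h
  rw [rank_dom, rank_ran]

lemma HasRestriction.isIdempotentElem {t b a : PlanarRook n} (h : HasRestriction t b a) :
    IsIdempotentElem a := by
  obtain ⟨s, _, rfl, rfl⟩ := h
  exact isIdempotentElem_ran s

lemma hasRestriction_one_iff {a b : PlanarRook n} (hb : IsIdempotentElem b) :
    HasRestriction 1 b a ↔ a = b := by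
  have hb1 : b ≤ 1 := le_iff_exists_idempotent.2 ⟨b, hb, (mul_one b).symm⟩
  constructor
  · intro h
    exact h.unique ⟨b, hb1, dom_of_isIdempotentElem hb, ran_of_isIdempotentElem hb⟩
  · rintro rfl
    exact ⟨a, hb1, dom_of_isIdempotentElem hb, ran_of_isIdempotentElem hb⟩

lemma mul_dom_apply {s t : PlanarRook n} {i a : Fin n} :
    (t * (s⁻¹ * s)).1 i = some a ↔ t.1 i = some a ∧ i ∈ s.domSet := by
  rw [mul_apply]
  simp only [dom_apply']
  constructor
  · rintro ⟨_, ⟨rfl, h⟩, h'⟩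
    exact ⟨h', h⟩
  · rintro ⟨h', h⟩
    exact ⟨i, ⟨rfl, h⟩, h'⟩

lemma mul_le_mul_of_le {s s' t t' : PlanarRook n} (hs : s ≤ s') (ht : t ≤ t') :
    s * t ≤ s' * t' := by
  rw [le_def]
  intro i a h
  obtain ⟨b, hb, hba⟩ := mul_apply.1 h
  exact mul_apply.2 ⟨b, le_def.1 ht _ _ hb, le_def.1 hs _ _ hba⟩

/-- This is the multiplicativity of `rankHom`: a restriction of `t * t'` factors through the image
`c` of `b` under `t'`, and composable restrictions compose to a restriction. -/
lemma hasRestriction_mul_iff {t t' a b : PlanarRook n} :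
    HasRestriction (t * t') b a ↔ ∃ c, HasRestriction t' b c ∧ HasRestriction t c a := by
  constructor
  · rintro ⟨s, hs, rfl, rfl⟩
    have hst : ∀ {i a}, s.1 i = some a → ∃ b, t'.1 i = some b ∧ t.1 b = some a := fun h =>
      mul_apply.1 (le_def.1 hs _ _ h)
    set u := t' * (s⁻¹ * s) with hu
    have hu' : ∀ {i b}, u.1 i = some b ↔ t'.1 i = some b ∧ i ∈ s.domSet := mul_dom_apply
    -- Here `t` is cut down to the range of `u`; writing that range as the domain of `u⁻¹` lets
    -- `mul_dom_apply` apply.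
    have hv' : ∀ {b a}, (t * (u⁻¹⁻¹ * u⁻¹)).1 b = some a ↔ t.1 b = some a ∧ b ∈ u⁻¹.domSet :=
      mul_dom_apply
    refine ⟨u * u⁻¹, ⟨u, ?_, ?_, rfl⟩, ⟨t * (u⁻¹⁻¹ * u⁻¹), ?_, ?_, ?_⟩⟩
    · rw [le_def]
      exact fun i b h => (hu'.1 h).1
    · rw [dom_eq_iff]
      ext i
      rw [mem_domSet]
      constructor
      · rintro ⟨b, hb⟩
        exact (hu'.1 hb).2
      · intro hi
        obtain ⟨a, ha⟩ := mem_domSet.1 hi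
        obtain ⟨b, hb, _⟩ := hst ha
        exact ⟨b, hu'.2 ⟨hb, hi⟩⟩
    · rw [le_def]
      exact fun i b h => (hv'.1 h).1
    · rw [show u * u⁻¹ = u⁻¹⁻¹ * u⁻¹ from rfl, dom_eq_iff]
      ext b
      rw [mem_domSet]
      constructor
      · rintro ⟨a, ha⟩
        exact (hv'.1 ha).2
      · intro hb
        obtain ⟨i, hi⟩ := mem_domSet_inv.1 hb
        obtain ⟨hi', his⟩ := hu'.1 hi
        obtain ⟨a, ha⟩ := mem_domSet.1 his
        obtain ⟨b', hb', hba⟩ := hst ha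
        rw [hi', Option.some.injEq] at hb'
        exact ⟨a, hv'.2 ⟨hb' ▸ hba, hb⟩⟩
    · rw [ran_eq_iff]
      ext a
      rw [mem_domSet_inv, mem_domSet_inv]
      constructor
      · rintro ⟨b, hb⟩
        obtain ⟨hba, hb'⟩ := hv'.1 hb
        obtain ⟨i, hi⟩ := mem_domSet_inv.1 hb'
        obtain ⟨hi', his⟩ := hu'.1 hi
        obtain ⟨a', ha'⟩ := mem_domSet.1 his
        obtain ⟨b', hb', hba'⟩ := hst ha'
        rw [hi', Option.some.injEq] at hb'
        subst hb'
        rw [hba, Option.some.injEq] at hba'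
        exact ⟨i, hba' ▸ ha'⟩
      · rintro ⟨i, hi⟩
        obtain ⟨b, hb, hba⟩ := hst hi
        have hub := hu'.2 ⟨hb, mem_domSet.2 ⟨a, hi⟩⟩
        exact ⟨b, hv'.2 ⟨hba, mem_domSet_inv.2 ⟨i, hub⟩⟩⟩
  · rintro ⟨c, ⟨u, hu, hub, huc⟩, ⟨v, hv, hvc, hva⟩⟩
    have h := hvc.trans huc.symm
    exact ⟨v * u, mul_le_mul_of_le hv hu, (dom_mul h).trans hub, (ran_mul h).trans hva⟩

open Classical in
/-- The action of the planar rook monoid on the idempotents of rank `k`, as matrices. -/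
def rankHom (n k : ℕ) : PlanarRook n →* Matrix (Idem n k) (Idem n k) ℂ where
  toFun t := Matrix.of fun a b => if HasRestriction t b.1 a.1 then 1 else 0
  map_one' := by
    ext a b
    simp [hasRestriction_one_iff b.2.1, Matrix.one_apply, Subtype.ext_iff]
  map_mul' t t' := by
    ext a b
    simp only [Matrix.of_apply, Matrix.mul_apply, mul_ite, mul_one, mul_zero, ← ite_and]
    by_cases h : ∃ c, HasRestriction t' b.1 c ∧ HasRestriction t c a.1
    · rw [if_pos (hasRestriction_mul_iff.2 h)]
      obtain ⟨c, hc, hca⟩ := h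
      -- The image of `b` under `t'` is unique and has the rank of `b`, so one term of the matrix
      -- product survives.
      rw [Finset.sum_eq_single ⟨c, hc.isIdempotentElem, hc.rank_eq.symm.trans b.2.2⟩]
      · exact (if_pos ⟨hc, hca⟩).symm
      · intro d _ hd
        exact if_neg fun h' => hd (Subtype.ext (h'.1.unique hc))
      · simp
    · rw [if_neg (mt hasRestriction_mul_iff.1 h)]
      exact (Finset.sum_eq_zero fun c _ => if_neg fun h' => h ⟨c.1, h'⟩).symm

/-- The irreducible representation of the semigroup algebra attached to the rank `k`. -/
def rankRep (n k : ℕ) : MonoidAlgebra ℂ (PlanarRook n) →ₐ[ℂ] Matrix (Idem n k) (Idem n k) ℂ :=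
  MonoidAlgebra.lift ℂ _ _ (rankHom n k)

open Classical in
lemma rankRep_apply {k : ℕ} (f : MonoidAlgebra ℂ (PlanarRook n)) (a b : Idem n k) :
    rankRep n k f a b = ∑ t, if HasRestriction t b.1 a.1 then f.coeff t else 0 := by
  rw [rankRep, MonoidAlgebra.lift_apply, Finsupp.sum_fintype _ _ (by simp), Matrix.sum_apply]
  simp [rankHom]

open Classical in
lemma rankRep_single_apply {k : ℕ} (t : PlanarRook n) (c : ℂ) (a b : Idem n k) :
    rankRep n k (MonoidAlgebra.single t c) a b = if HasRestriction t b.1 a.1 then c else 0 := by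
  simp [rankRep, rankHom]

open Classical in
-- The entry is the sum of `μ(t, s)` over `u ≤ t ≤ s`, which vanishes unless `u = s` by the defining
-- property of the Möbius function.
lemma rankRep_groupoidElt_apply {k : ℕ} (s u : PlanarRook n) (hu : u.rank = k) :
    rankRep n k (groupoidElt s) (u.ran hu) (u.dom hu) = if u = s then 1 else 0 := by
  rw [← IncidenceAlgebra.sum_Icc_mu_left (𝕜 := ℂ), groupoidElt, map_sum, Matrix.sum_apply]
  simp only [rankRep_single_apply, ran, dom, hasRestriction_dom_ran_iff]
  rw [← Finset.sum_filter]
  refine Finset.sum_congr ?_ fun _ _ => rfl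
  ext t
  simp [and_comm]

lemma exists_ran_dom_eq {k : ℕ} (a b : Idem n k) :
    ∃ (u : PlanarRook n) (hu : u.rank = k), u.ran hu = a ∧ u.dom hu = b := by
  obtain ⟨u, hb, ha⟩ := exists_dom_eq_ran_eq b.2.1 a.2.1 (b.2.2.trans a.2.2.symm)
  refine ⟨u, ?_, Subtype.ext ha, Subtype.ext hb⟩
  rw [← rank_dom, hb, b.2.2]

lemma eq_of_ran_eq_of_dom_eq {k : ℕ} {s u : PlanarRook n} {hs : s.rank = k} {hu : u.rank = k}
    (hr : s.ran hs = u.ran hu) (hd : s.dom hs = u.dom hu) : s = u :=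
  eq_of_dom_eq_of_ran_eq (congrArg Subtype.val hd) (congrArg Subtype.val hr)

lemma rankRep_groupoidElt {k : ℕ} (s : PlanarRook n) (hs : s.rank = k) :
    rankRep n k (groupoidElt s) = Matrix.single (s.ran hs) (s.dom hs) 1 := by
  ext a b
  obtain ⟨u, hu, rfl, rfl⟩ := exists_ran_dom_eq a b
  rw [rankRep_groupoidElt_apply, Matrix.single_apply]
  congr 1
  refine propext ⟨?_, fun h => (eq_of_ran_eq_of_dom_eq h.1 h.2).symm⟩
  rintro rfl
  exact ⟨rfl, rfl⟩

lemma rankRep_groupoidElt_of_rank_ne {k : ℕ} (s : PlanarRook n) (hs : s.rank ≠ k) :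
    rankRep n k (groupoidElt s) = 0 := by
  ext a b
  obtain ⟨u, hu, rfl, rfl⟩ := exists_ran_dom_eq a b
  rw [rankRep_groupoidElt_apply, if_neg, Matrix.zero_apply]
  rintro rfl
  exact hs hu

instance nonempty_idem (k : Fin (n + 1)) : Nonempty (Idem n k) := by
  obtain ⟨A, _, hA⟩ := Finset.exists_subset_card_eq (s := (Finset.univ : Finset (Fin n)))
    (n := k) (by simpa using Nat.lt_succ_iff.1 k.isLt)
  obtain ⟨s, hs, _⟩ := exists_domSet_eq (rfl : A.card = A.card)
  exact ⟨s.dom (by rw [← card_domSet, hs, hA])⟩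

lemma isInducedFromTrivial_rankRep (k : Fin (n + 1)) : IsInducedFromTrivial (rankRep n k) := by
  obtain ⟨e⟩ := nonempty_idem k
  have hex : ∀ a : Idem n k, ∃ x : PlanarRook n, x⁻¹ * x = e.1 ∧ x * x⁻¹ = a.1 := fun a =>
    exists_dom_eq_ran_eq e.2.1 a.2.1 (e.2.2.trans a.2.2.symm)
  choose p hpd hpr using hex
  refine ⟨e, p, ?_, fun a => ⟨hpd a, hpr a⟩, fun s h => ⟨?_, rankRep_groupoidElt s h⟩,
    rankRep_groupoidElt_of_rank_ne⟩
  · exact eq_of_dom_eq_of_ran_eq ((hpd e).trans (dom_of_isIdempotentElem e.2.1).symm)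
      ((hpr e).trans (ran_of_isIdempotentElem e.2.1).symm)
  -- Consecutive factors of the product are composable with matching domain and range, so its domain
  -- and range can be read off at the two ends; both are `e`.
  · have h₁ : (p (s.ran h))⁻¹⁻¹ * (p (s.ran h))⁻¹ = s * s⁻¹ := hpr (s.ran h)
    have h₂ : ((p (s.ran h))⁻¹ * s)⁻¹ * ((p (s.ran h))⁻¹ * s) =
        p (s.dom h) * (p (s.dom h))⁻¹ := (dom_mul h₁).trans (hpr (s.dom h)).symm
    exact ⟨(dom_mul h₂).trans (hpd _), (ran_mul h₂).trans ((ran_mul h₁).trans (hpd _))⟩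

/-! ### The Fourier transform -/

lemma fourierIndex_bijective : Function.Bijective (fourierIndex (n := n)) := by
  constructor
  · intro s t h
    have h₁ : (s.fourierIndex.2.1).1 = (t.fourierIndex.2.1).1 := by rw [h]
    have h₂ : (s.fourierIndex.2.2).1 = (t.fourierIndex.2.2).1 := by rw [h]
    exact eq_of_dom_eq_of_ran_eq h₂ h₁
  · rintro ⟨⟨k, hk⟩, a, b⟩
    obtain ⟨u, hu, ha, hb⟩ := exists_ran_dom_eq (k := k) a b
    subst hu
    subst ha hb
    exact ⟨u, rfl⟩

variable (n) in
/-- The representations `rankRep n k` for `0 ≤ k ≤ n`. -/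
abbrev rankReps (k : Fin (n + 1)) :
    MonoidAlgebra ℂ (PlanarRook n) →ₐ[ℂ] Matrix (Idem n k) (Idem n k) ℂ :=
  rankRep n k

/-- The only element with the domain and range of `s` is `s` itself, so `t` has such a restriction
exactly when `s ≤ t`. -/
lemma fourierTransform_fourierIndex (f : MonoidAlgebra ℂ (PlanarRook n)) (s : PlanarRook n) :
    fourierTransform (rankReps n) f s.fourierIndex = zetaTransform (fun t => f.coeff t) s := by
  classical
  rw [fourierTransform, rankRep_apply, zetaTransform, Finset.sum_filter]
  refine Finset.sum_congr rfl fun t _ => ?_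
  simp only [fourierIndex, ran, dom, hasRestriction_dom_ran_iff]

lemma fourierTransform_eq (f : MonoidAlgebra ℂ (PlanarRook n)) :
    fourierTransform (rankReps n) f = fun z => zetaTransform (fun t => f.coeff t)
      ((Equiv.ofBijective _ fourierIndex_bijective).symm z) := by
  ext z
  obtain ⟨s, rfl⟩ := (Equiv.ofBijective _ fourierIndex_bijective).surjective z
  rw [Equiv.symm_apply_apply]
  exact fourierTransform_fourierIndex f s

lemma fourierTransform_bijective : Function.Bijective (fourierTransform (rankReps n)) := by
  have h : fourierTransform (rankReps n) =
      (fun g => g ∘ (Equiv.ofBijective _ fourierIndex_bijective).symm) ∘ zetaTransform ∘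
        fun f : MonoidAlgebra ℂ (PlanarRook n) => fun t => f.coeff t :=
    funext fourierTransform_eq
  rw [h]
  refine Function.Bijective.comp ?_ (zetaTransform_bijective.comp ?_)
  · exact ((Equiv.ofBijective _ fourierIndex_bijective).arrowCongr (Equiv.refl ℂ)).bijective
  · exact (MonoidAlgebra.coeffEquiv.trans Finsupp.equivFunOnFinite).bijective

lemma coeff_eq_moebiusTransform (f : MonoidAlgebra ℂ (PlanarRook n)) (s : PlanarRook n) :
    f.coeff s =
      moebiusTransform (fun t => fourierTransform (rankReps n) f t.fourierIndex) s := by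
  simp only [fourierTransform_fourierIndex]
  exact (congrFun (moebiusTransform_zetaTransform _) s).symm

/-! ### Operation counts for the Fourier transform and its inverse -/

lemma isLinComputable_fourierTransform :
    IsLinComputable (2 * (n * n * Fintype.card (PlanarRook n)))
      (fun (f : MonoidAlgebra ℂ (PlanarRook n)) s => f.coeff s)
      (fourierTransform (rankReps n)) := by
  rw [funext fourierTransform_eq]
  simpa using (isLinComputable_zetaTransform graph exists_graph_eq
    (fun (f : MonoidAlgebra ℂ (PlanarRook n)) s => f.coeff s)
    (IsLinComputable.inputs id)).reindex (Equiv.ofBijective _ fourierIndex_bijective).symm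

lemma isLinComputable_inverseFourierTransform :
    IsLinComputable (2 * (n * n * Fintype.card (PlanarRook n)))
      (fourierTransform (rankReps n))
      (fun (f : MonoidAlgebra ℂ (PlanarRook n)) s => f.coeff s) := by
  simpa using isLinComputable_of_zetaTransform graph exists_graph_eq
    (inp := fourierTransform (rankReps n))
    (fun (f : MonoidAlgebra ℂ (PlanarRook n)) s => f.coeff s) (by
      simpa only [fourierTransform_fourierIndex] using
        IsLinComputable.inputs (inp := fourierTransform (rankReps n)) fourierIndex)

/-- Every subset of `Fin n` is a domain, for instance that of a partial identity. -/
lemma two_pow_le_card : 2 ^ n ≤ Fintype.card (PlanarRook n) := by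
  have h : Function.Surjective (domSet : PlanarRook n → Finset (Fin n)) := fun A =>
    let ⟨s, hs, _⟩ := exists_domSet_eq (rfl : A.card = A.card)
    ⟨s, hs⟩
  simpa using Fintype.card_le_of_surjective _ h

/-- From `2 ^ n ≤ |P_n|` follows `n ≤ log |P_n| / log 2`. Squaring this and keeping the factor `2`
for one multiplication and one addition per update gives the constant. -/
lemma operations_le {m : ℕ} (hm : m ≤ 2 * (n * n * Fintype.card (PlanarRook n))) :
    (m : ℝ) ≤ 2 / Real.log 2 ^ 2 * (Fintype.card (PlanarRook n) *
      Real.log (Fintype.card (PlanarRook n)) ^ 2) := by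
  have hlog2 : 0 < Real.log 2 := Real.log_pos one_lt_two
  have hlog : n * Real.log 2 ≤ Real.log (Fintype.card (PlanarRook n)) := by
    rw [← Real.log_pow]
    exact Real.log_le_log (by positivity) (by exact_mod_cast two_pow_le_card)
  have hsq : (n * Real.log 2) ^ 2 ≤ Real.log (Fintype.card (PlanarRook n)) ^ 2 := by
    gcongr
  calc (m : ℝ) ≤ 2 * (n * n * Fintype.card (PlanarRook n)) := by exact_mod_cast hm
    _ = 2 / Real.log 2 ^ 2 * (Fintype.card (PlanarRook n) * (n * Real.log 2) ^ 2) := by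
      field_simp
    _ ≤ _ := by gcongr

lemma setOf_isJoinIrreducible_latticeCompletion :
    {j : LatticeCompletion (PlanarRook n) | IsJoinIrreducible j} =
      LatticeCompletion.of '' {s | s.rank = 1} := by
  rw [LatticeCompletion.setOf_isJoinIrreducible isMeetSemilatticeOrder
    fun _ _ _ ha hb => exists_isLUB ha hb]
  simp only [existsUnique_covBy_iff]

end PlanarRook

end

theorem theorem5p5 :
    ∃ C : ℝ, ∀ n : ℕ,
      -- the `𝒟`-classes are the sets of elements of fixed rank; maximal subgroups are trivial
      (∀ s t : PlanarRook n, PlanarRook.DRel s t ↔ s.rank = t.rank) ∧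
      (∀ e : PlanarRook n, IsIdempotentElem e → PlanarRook.maxSubgroup e = {e}) ∧
      -- `P_n` is a meet-semilattice; the lattice `L(P_n)` has exactly `n ^ 2` join-irreducibles,
      -- namely the elements of rank one
      IsMeetSemilatticeOrder (PlanarRook n) ∧
      IsLatticeOrder (LatticeCompletion (PlanarRook n)) ∧
      {j : LatticeCompletion (PlanarRook n) | IsJoinIrreducible j} =
        {j | ∃ s : PlanarRook n, j.1 = (s : WithTop (PlanarRook n)) ∧ s.rank = 1} ∧
      {j : LatticeCompletion (PlanarRook n) | IsJoinIrreducible j}.ncard = n ^ 2 ∧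
      -- one representation for each rank, induced from the trivial maximal subgroups
      ∃ Y : (k : Fin (n + 1)) → MonoidAlgebra ℂ (PlanarRook n) →ₐ[ℂ]
          Matrix (PlanarRook.Idem n k) (PlanarRook.Idem n k) ℂ,
        (∀ k, PlanarRook.IsInducedFromTrivial (Y k)) ∧
        IsCompleteIrreps Y ∧
        Function.Bijective (fourierTransform Y) ∧
        -- the transforms reduce to the zeta and Möbius transforms
        Function.Bijective (PlanarRook.fourierIndex (n := n)) ∧
        (∀ (f : MonoidAlgebra ℂ (PlanarRook n)) (s : PlanarRook n),
          fourierTransform Y f s.fourierIndex = zetaTransform (fun t => f.coeff t) s) ∧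
        (∀ (f : MonoidAlgebra ℂ (PlanarRook n)) (s : PlanarRook n),
          f.coeff s = moebiusTransform (fun t => fourierTransform Y f t.fourierIndex) s) ∧
        -- the Fourier transform
        (∃ (m : ℕ)
          (P : LinProg (PlanarRook n)
            (Σ k : Fin (n + 1), PlanarRook.Idem n k × PlanarRook.Idem n k) m),
          (m : ℝ) ≤ C * (Fintype.card (PlanarRook n) *
            Real.log (Fintype.card (PlanarRook n)) ^ 2) ∧
          ∀ f : MonoidAlgebra ℂ (PlanarRook n),
            P.Computes (fun s => f.coeff s) (fourierTransform Y f)) ∧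
        -- the inverse Fourier transform
        (∃ (m : ℕ)
          (P : LinProg (Σ k : Fin (n + 1), PlanarRook.Idem n k × PlanarRook.Idem n k)
            (PlanarRook n) m),
          (m : ℝ) ≤ C * (Fintype.card (PlanarRook n) *
            Real.log (Fintype.card (PlanarRook n)) ^ 2) ∧
          ∀ f : MonoidAlgebra ℂ (PlanarRook n),
            P.Computes (fourierTransform Y f) (fun s => f.coeff s)) := by
  refine ⟨2 / Real.log 2 ^ 2, fun n => ⟨PlanarRook.dRel_iff, fun _ => PlanarRook.maxSubgroup_eq,
    PlanarRook.isMeetSemilatticeOrder,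
    LatticeCompletion.isLatticeOrder PlanarRook.isMeetSemilatticeOrder
      fun _ _ _ ha hb => PlanarRook.exists_isLUB ha hb, ?_, ?_, PlanarRook.rankReps n,
    PlanarRook.isInducedFromTrivial_rankRep,
    isCompleteIrreps_of_bijective PlanarRook.fourierTransform_bijective,
    PlanarRook.fourierTransform_bijective, PlanarRook.fourierIndex_bijective,
    PlanarRook.fourierTransform_fourierIndex, PlanarRook.coeff_eq_moebiusTransform, ?_, ?_⟩⟩
  · rw [PlanarRook.setOf_isJoinIrreducible_latticeCompletion]
    ext j
    constructor
    · rintro ⟨s, hs, rfl⟩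
      exact ⟨s, rfl, hs⟩
    · rintro ⟨s, hj, hs⟩
      exact ⟨s, hs, Subtype.ext hj.symm⟩
  · rw [PlanarRook.setOf_isJoinIrreducible_latticeCompletion,
      Set.ncard_image_of_injective _ LatticeCompletion.of.injective, PlanarRook.ncard_rank_one]
  · obtain ⟨m, hm, P, hP⟩ := PlanarRook.isLinComputable_fourierTransform (n := n)
    exact ⟨m, P, PlanarRook.operations_le hm, hP⟩
  · obtain ⟨m, hm, P, hP⟩ := PlanarRook.isLinComputable_inverseFourierTransform (n := n)
    exact ⟨m, P, PlanarRook.operations_le hm, hP⟩
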